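/- Let $\alpha>1$, $1/\alpha+1/\beta=1$, $\delta<-1$, $\Phi(u)=|u|^{\alpha-1}\operatorname{sgn}u$, $\varrho=\frac{-1-\delta}{\alpha-1}$. Let $r,p$ be positive continuous functions on $[a,\infty)$ and let $\tau\in C^1[a,\infty)$ satisfy $\tau'>0$, $\tau(t)\le t$, $\tau(t)>0$ for large $t$, and $\limsup_{t\to\infty}t/\tau(t)<\infty$. Consider the equation $$(r(t)\Phi(y'))'=p(t)\Phi(y(\tau(t))).\qquad (E)$$ Notation. All classes of functions below concern behaviour for large $t$. $\mathrm{RV}(\vartheta)$ is the class of (eventually) positive measurable $f$ with $f(\lambda t)/f(t)\to\lambda^\vartheta$ as $t\to\infty$ for every $\lambda>0$; $\mathrm{SV}=\mathrm{RV}(0)$; $L_f(t)=f(t)/t^{\vartheta}$ for $f\in\mathrm{RV}(\vartheta)$. $f\in\mathrm{NRV}(\vartheta)$ means that $f(t)=C\,t^{\vartheta}\exp\{\int_{t_1}^t\psi(s)/s\,ds\}$ for $t\ge t_1$, with some $t_1>0$, $C>0$ and measurable $\psi(t)\to0$. $f\in\Pi(w)$ means that $f$ is measurable, $w$ is positive and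 $(f(\lambda t)-f(t))/w(t)\to\ln\lambda$ for every $\lambda>0$. $\mathcal S$ is the class of functions that are positive solutions of (E) for large $t$ ($y$ and $y^{[1]}:=r\Phi(y')$ are $C^1$); $\mathcal{IS}$ is the class of $y\in\mathcal S$ with $y'(t)>0$ for large $t$; $\mathcal{IS}_{\infty,\infty}$ [$\mathcal{IS}_{\infty,B}$] is the class of $y\in\mathcal{IS}$ with $y(t)\to\infty$ and $y^{[1]}(t)\to\infty$ [with $y(t)\to\infty$ and $y^{[1]}(t)$ tending to a nonzero real number]; $\mathcal S_{\mathrm{RV}}(\varrho)=\mathcal S\cap\mathrm{RV}(\varrho)$, $\mathcal S_{\mathrm{NRV}}(\varrho)=\mathcal S\cap\mathrm{NRV}(\varrho)$. Finally $H_\tau(t)=(t\tau'(t))^{\alpha-1}\dfrac{p(t)}{r(\tau(t))}$. Theorem. Assume $p\in\mathrm{RV}(\delta)$, $r\in\mathrm{RV}(\delta+\alpha)$, $$(r^{1-\beta}\circ\tau)\,\tau'\in\mathrm{RV}(\delta(1-\beta)-\beta)\quad\text{and}\quad\Big(\frac{L_p(t)}{L_r(t)}\Big)^{\beta-1}\tau'(t)\to0\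 \text{ as }t\to\infty.$$ Then $\mathcal{IS}\subset\mathrm{NRV}(\varrho)$, and $y^{[1]}\in\Pi\big(t\,p(t)\,\Phi(y(\tau(t)))\big)$ for every $y\in\mathcal{IS}$. Moreover, let $t_0\ge\max\{0,a\}$ be any number with $\tau(t_0)\ge a$ (so that $H_\tau$ is defined, continuous and nonnegative on $[t_0,\infty)$). Then for every $y\in\mathcal{IS}$: (i) If $\int_{t_0}^\infty H_\tau(s)\,ds=\infty$, then there is $\varepsilon(t)\to0$ such that for all large $t$ $$y(t)=t\,r^{1-\beta}(t)\exp\Big\{\int_{t_0}^t(1+\varepsilon(t))\frac{\beta-1}{\Phi(\varrho)}H_\tau(s)\,ds\Big\};$$ more precisely, there are $\eta(t)\to0$ and a continuous $\varepsilon$ on $[t_0,\infty)$ with $\varepsilon(s)\to0$ such that for all large $t$ $$y(t)=\frac{1+\eta(t)}{\varrho}\,t\,r^{1-\beta}(t)\exp\Big\{\int_{t_0}^t(1+\varepsilon(s))\frac{\beta-1}{\Phi(\varrho)}H_\tau(s)\,ds\Big\}.$$ Moreover, $\mathcal S_{\mathrm{NRV}}(\varrho)=\mathcal S_{\mathrm{RV}}(\varrho)=\mathcal{IS}=\mathcal{IS}_{\infty,\infty}$.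 (ii) If $\int_{t_0}^\infty H_\tau(s)\,ds<\infty$, then $M:=\lim_{t\to\infty}y^{[1]}(t)\in(0,\infty)$ exists, and there are $A\in\mathbb R$ and a continuous $\varepsilon$ on $[t_0,\infty)$ with $\varepsilon(\xi)\to0$ such that for all large $t$ $$y(t)=A+\int_{t_0}^tM^{\beta-1}r^{1-\beta}(s)\exp\Big\{-\int_s^\infty(1+\varepsilon(\xi))\frac{\beta-1}{\varrho^{\alpha-1}}H_\tau(\xi)\,d\xi\Big\}\,ds .$$ Moreover, $\mathcal S_{\mathrm{NRV}}(\varrho)=\mathcal S_{\mathrm{RV}}(\varrho)=\mathcal{IS}=\mathcal{IS}_{\infty,B}$, $M-y^{[1]}\in\mathrm{SV}$, and $$\frac{t^{\delta+\alpha}(\tau'(t))^{\alpha-1}L_p(t)}{\tau^{\delta+\alpha}(t)\,L_r(t)\,(M-y^{[1]}(t))}\to0\quad\text{as }t\to\infty.$$ -/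

import Mathlib

open Set Filter Topology MeasureTheory

namespace HalfLinearDelay

noncomputable section

/-- The odd power `Φ(u) = |u|^(α-1) sgn u`. -/
def Phi (α u : ℝ) : ℝ := |u| ^ (α - 1) * Real.sign u

/-- `f ∈ RV(ϑ)`: `f` is positive and measurable on some `[A, ∞)` and
`f(λ t) / f(t) → λ ^ ϑ` as `t → ∞`, for every `λ > 0`. -/
def IsRV (f : ℝ → ℝ) (ϑ : ℝ) : Prop :=
  (∃ A : ℝ, (∀ t, A ≤ t → 0 < f t) ∧ Measurable ((Ici A).domRestrict f)) ∧
    ∀ l : ℝ, 0 < l → Tendsto (fun t => f (l * t) / f t) atTop (𝓝 (l ^ ϑ))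

/-- `f ∈ SV`: slow variation. -/
def IsSV (f : ℝ → ℝ) : Prop := IsRV f 0

/-- `f ∈ NRV(ϑ)`: for large `t`, `f(t) = C t^ϑ exp (∫_{t₁}^t ψ(s)/s ds)` with a constant `C > 0` and
a measurable `ψ` such that `ψ(t) → 0` (and such that the integral makes sense). -/
def IsNRV (f : ℝ → ℝ) (ϑ : ℝ) : Prop :=
  ∃ (t₁ C : ℝ) (ψ : ℝ → ℝ), 0 < t₁ ∧ 0 < C ∧ Measurable ψ ∧ Tendsto ψ atTop (𝓝 0) ∧
    (∀ t, t₁ ≤ t → IntervalIntegrable (fun s => ψ s / s) volume t₁ t) ∧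
    ∀ t, t₁ ≤ t → f t = C * t ^ ϑ * Real.exp (∫ s in t₁..t, ψ s / s)

/-- `f ∈ Π(w)`: de Haan's class, with auxiliary function `w`. -/
def IsPi (f w : ℝ → ℝ) : Prop :=
  (∃ A : ℝ, (∀ t, A ≤ t → 0 < w t) ∧ Measurable ((Ici A).domRestrict f)) ∧
    ∀ l : ℝ, 0 < l → Tendsto (fun t => (f (l * t) - f t) / w t) atTop (𝓝 (Real.log l))

/-- The slowly varying component `L_f(t) = f(t) / t^ϑ` of a function `f ∈ RV(ϑ)`. -/
def svPart (f : ℝ → ℝ) (ϑ t : ℝ) : ℝ := f t / t ^ ϑ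

/-- The quasiderivative `y^{[1]} = r Φ(y')`. -/
def quasiDeriv (α : ℝ) (r y : ℝ → ℝ) (t : ℝ) : ℝ := r t * Phi α (deriv y t)

/-- The class `S` of the functions which, for large `t`, are positive (classical) solutions of
`(r Φ(y'))' = p Φ(y ∘ τ)`. The coefficients live on `[a, ∞)`. -/
def Sol (α a : ℝ) (r p τ : ℝ → ℝ) : Set (ℝ → ℝ) :=
  {y | ∃ T : ℝ, a ≤ T ∧ (∀ t, T < t → 0 < y t) ∧
    ContDiffOn ℝ 1 y (Ioi T) ∧ ContDiffOn ℝ 1 (quasiDeriv α r y) (Ioi T) ∧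
    ∀ t, T < t → HasDerivAt (quasiDeriv α r y) (p t * Phi α (y (τ t))) t}

/-- The class `IS` of eventually positive increasing solutions. -/
def IS (α a : ℝ) (r p τ : ℝ → ℝ) : Set (ℝ → ℝ) :=
  {y | y ∈ Sol α a r p τ ∧ ∀ᶠ t in atTop, 0 < deriv y t}

/-- The class `IS_{∞,∞}`. -/
def ISInfInf (α a : ℝ) (r p τ : ℝ → ℝ) : Set (ℝ → ℝ) :=
  {y | y ∈ IS α a r p τ ∧ Tendsto y atTop atTop ∧ Tendsto (quasiDeriv α r y) atTop atTop}

/-- The class `IS_{∞,B}`; the limit of the quasiderivative is a nonzero real number. -/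
def ISInfB (α a : ℝ) (r p τ : ℝ → ℝ) : Set (ℝ → ℝ) :=
  {y | y ∈ IS α a r p τ ∧ Tendsto y atTop atTop ∧
    ∃ v : ℝ, v ≠ 0 ∧ Tendsto (quasiDeriv α r y) atTop (𝓝 v)}

/-- Regularly varying solutions of index `ϑ`. -/
def SolRV (α a : ℝ) (r p τ : ℝ → ℝ) (ϑ : ℝ) : Set (ℝ → ℝ) :=
  {y | y ∈ Sol α a r p τ ∧ IsRV y ϑ}

/-- Normalized regularly varying solutions of index `ϑ`. -/
def SolNRV (α a : ℝ) (r p τ : ℝ → ℝ) (ϑ : ℝ) : Set (ℝ → ℝ) :=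
  {y | y ∈ Sol α a r p τ ∧ IsNRV y ϑ}

/-- The derivative of `τ` on `[a, ∞)` (one-sided at `a`). -/
def tauDeriv (a : ℝ) (τ : ℝ → ℝ) (t : ℝ) : ℝ := derivWithin τ (Ici a) t

/-- `H_τ(t) = (t τ'(t))^(α-1) p(t) / r(τ(t))`. -/
def Htau (α a : ℝ) (r p τ : ℝ → ℝ) (t : ℝ) : ℝ :=
  (t * tauDeriv a τ t) ^ (α - 1) * (p t / r (τ t))

/-- The index `ϱ = (-1-δ)/(α-1)`. -/
def rvIndex (α δ : ℝ) : ℝ := (-1 - δ) / (α - 1)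

end

end HalfLinearDelay

open HalfLinearDelay

/-!
The argument reduces everything to the slow variation of the quasiderivative `q = r Φ(y')` of an
increasing solution, for which `y' = q^(β-1) r^(1-β)`.

Since `q` increases, integrating `(y ∘ τ)' = (q ∘ τ)^(β-1) R` with `R = (r ∘ τ)^(1-β) τ'` bounds
`y ∘ τ` by a multiple of `q^(β-1) ∫ R`, and Karamata's theorem turns `∫ R` into `t R(t) / ϱ`. Inserted
into the equation this gives `t q' / q ≤ C t H_τ(t)`. The hypothesis on `(L_p / L_r)^(β-1) τ'` says
precisely that `t H_τ(t) → 0`, because `r ∘ τ` and `r` are comparable when `t / τ(t)` is bounded. So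
`q` is slowly varying (`IsGrowingFrom.tendsto_elasticity_q`), `y'` is regularly varying of index
`ϱ - 1`, and Karamata's theorem gives `t y' / y → ϱ`, that is `y ∈ NRV(ϱ)`.

With `q` slowly varying, `q ∘ τ ∼ q`, and the bound on `y ∘ τ` sharpens to an equivalence. Hence `q'`
is regularly varying of index `-1`, which by uniform convergence is the membership in de Haan's class,
and `q' / q ∼ H_τ / ϱ^(α-1)` (`IsGrowingFrom.tendsto_deriv_q_div`). Integrating this relation decides
whether `q` is unbounded and gives both representation formulas. When `q → M < ∞`, the difference
`M - q(t)` exceeds every increment `q(λt) - q(t) ∼ t q'(t) log λ`, so `t q' = o(M - q)`, and the last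
two assertions follow. Conversely, a solution in `RV(ϱ)` is unbounded, so its eventually monotone
quasiderivative must be eventually positive.

The facts on regular variation rest on Potter's bounds (`IsRV.potter`), which are derived here together
with the uniform convergence theorem for measurable functions: after passing to logarithms, the
increments over a shift `u` are controlled by averages that tend to zero by dominated convergence.
-/

namespace HalfLinearDelay

/-! ### Uniform convergence and Potter bounds -/

/-- The uniform convergence theorem in additive form. Averages over `v ∈ [0, 2]` of the truncated
increments `min 1 |h(x + v) - h(x)|` tend to zero by dominated convergence, and they control every
single increment. -/
theorem exists_forall_abs_shift_le {h : ℝ → ℝ} (hm : Measurable h)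
    (hs : ∀ u, Tendsto (fun x => h (x + u) - h x) atTop (𝓝 0)) {ε : ℝ} (hε : 0 < ε) :
    ∃ X, ∀ x, X ≤ x → ∀ u ∈ Icc (0 : ℝ) 1, |h (x + u) - h x| ≤ ε := by
  set g : ℝ → ℝ → ℝ := fun x v => min 1 |h (x + v) - h x| with hg
  have g0 : ∀ x v, 0 ≤ g x v := fun x v => le_min zero_le_one (abs_nonneg _)
  have g1 : ∀ x v, g x v ≤ 1 := fun x v => min_le_left _ _
  have gm : ∀ x, Measurable (g x) := fun x => by
    have : Measurable fun v => h (x + v) := hm.comp (measurable_const_add x)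
    exact measurable_const.min ((this.sub_const _).abs)
  have gi : ∀ x c d, IntervalIntegrable (g x) volume c d := fun x c d =>
    (intervalIntegrable_const (c := (1 : ℝ))).mono_fun (gm x).aestronglyMeasurable
      (Eventually.of_forall fun v => by
        show ‖g x v‖ ≤ ‖(1 : ℝ)‖
        rw [Real.norm_of_nonneg (g0 x v), norm_one]; exact g1 x v)
  have hG : Tendsto (fun x => ∫ v in (0 : ℝ)..2, g x v) atTop (𝓝 0) := by
    have := intervalIntegral.tendsto_integral_filter_of_dominated_convergence
      (μ := volume) (a := 0) (b := 2) (l := atTop) (F := g) (f := fun _ => (0 : ℝ))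
      (fun _ => (1 : ℝ))
      (Eventually.of_forall fun x => (gm x).aestronglyMeasurable)
      (Eventually.of_forall fun x => Eventually.of_forall fun v _ => by
        rw [Real.norm_of_nonneg (g0 x v)]; exact g1 x v)
      intervalIntegrable_const
      (Eventually.of_forall fun v _ => by
        have h1 := (hs v).abs
        simpa [hg] using (tendsto_const_nhds (x := (1 : ℝ))).min h1)
    simpa using this
  have hδ : 0 < min 1 ε / 2 := by positivity
  obtain ⟨X, hX⟩ := eventually_atTop.1 (hG.eventually (gt_mem_nhds hδ))
  refine ⟨X, fun x hx u hu => ?_⟩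
  -- Both `x` and `x + u` are compared with `x + (u + v)`, and the comparison is averaged over `v`.
  have key : ∀ v, g x u ≤ g x (u + v) + g (x + u) v := by
    intro v
    have tri : |h (x + u) - h x| ≤ |h (x + (u + v)) - h x| + |h (x + u + v) - h (x + u)| := by
      rw [add_assoc]
      have := abs_sub_abs_le_abs_sub (h (x + u) - h x) (h (x + (u + v)) - h x)
      have h2 : h (x + u) - h x - (h (x + (u + v)) - h x) = -(h (x + (u + v)) - h (x + u)) := by
        ring
      rw [h2, abs_neg] at this
      linarith
    simp only [hg]
    rcases min_choice 1 |h (x + (u + v)) - h x| with e | e <;>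
    rcases min_choice 1 |h (x + u + v) - h (x + u)| with e' | e' <;> rw [e, e']
    · linarith [min_le_left 1 |h (x + u) - h x|]
    · linarith [min_le_left 1 |h (x + u) - h x|, abs_nonneg (h (x + u + v) - h (x + u))]
    · linarith [min_le_left 1 |h (x + u) - h x|, abs_nonneg (h (x + (u + v)) - h x)]
    · exact (min_le_right _ _).trans tri
  have i1 : IntervalIntegrable (fun v => g x (u + v)) volume 0 1 := by
    have := (gi x (u + 0) (u + 1)).comp_add_left (c := u)
    simpa using this
  have I : g x u ≤ (∫ v in (0 : ℝ)..1, g x (u + v)) + ∫ v in (0 : ℝ)..1, g (x + u) v := by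
    rw [← intervalIntegral.integral_add i1 (gi _ _ _)]
    have := intervalIntegral.integral_mono_on (a := (0 : ℝ)) (b := 1) zero_le_one
      (intervalIntegrable_const (c := g x u)) (i1.add (gi (x + u) 0 1)) fun v _ => key v
    simpa using this
  have I1 : (∫ v in (0 : ℝ)..1, g x (u + v)) ≤ ∫ v in (0 : ℝ)..2, g x v := by
    rw [intervalIntegral.integral_comp_add_left]
    exact intervalIntegral.integral_mono_interval (by linarith [hu.1]) (by linarith)
      (by linarith [hu.2]) (Eventually.of_forall fun v => g0 x v) (gi _ _ _)
  have I2 : (∫ v in (0 : ℝ)..1, g (x + u) v) ≤ ∫ v in (0 : ℝ)..2, g (x + u) v :=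
    intervalIntegral.integral_mono_interval le_rfl zero_le_one (by norm_num)
      (Eventually.of_forall fun v => g0 (x + u) v) (gi _ _ _)
  have h1 := hX x hx
  have h2 := hX (x + u) (by linarith [hu.1])
  have h3 : g x u < min 1 ε := by linarith
  rcases min_lt_iff.1 (show min 1 |h (x + u) - h x| < min 1 ε from h3) with h4 | h4
  · exact absurd h4 (not_lt.2 (min_le_left _ _))
  · exact (h4.le).trans (min_le_right _ _)

/-- Potter's bound in additive form: a long shift is split into steps of length at most one. -/
theorem exists_forall_abs_shift_le_mul {h : ℝ → ℝ} (hm : Measurable h)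
    (hs : ∀ u, Tendsto (fun x => h (x + u) - h x) atTop (𝓝 0)) {ε : ℝ} (hε : 0 < ε) :
    ∃ X, ∀ x, X ≤ x → ∀ u, 0 ≤ u → |h (x + u) - h x| ≤ ε * (u + 1) := by
  obtain ⟨X, hX⟩ := exists_forall_abs_shift_le hm hs hε
  have key : ∀ n : ℕ, ∀ x, X ≤ x → ∀ u : ℝ, 0 ≤ u → u ≤ n → |h (x + u) - h x| ≤ ε * n := by
    intro n
    induction n with
    | zero =>
      intro x _ u hu hun
      have : u = 0 := le_antisymm (by simpa using hun) hu
      simp [this]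
    | succ n ih =>
      intro x hx u hu hun
      push_cast at hun ⊢
      rcases le_total u 1 with h1 | h1
      · refine (hX x hx u ⟨hu, h1⟩).trans ?_
        nlinarith [mul_nonneg hε.le (Nat.cast_nonneg (α := ℝ) n)]
      · have a1 := hX x hx 1 ⟨zero_le_one, le_rfl⟩
        have a2 := ih (x + 1) (by linarith) (u - 1) (by linarith) (by linarith)
        have e : x + 1 + (u - 1) = x + u := by ring
        rw [e] at a2
        have := abs_sub_le (h (x + u)) (h (x + 1)) (h x)
        linarith
  refine ⟨X, fun x hx u hu => (key ⌈u⌉₊ x hx u hu (Nat.le_ceil u)).trans ?_⟩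
  exact mul_le_mul_of_nonneg_left (Nat.ceil_lt_add_one hu).le hε.le

/-- Freezing the argument below `A` extends a function measurable on `[A, ∞)` to the whole line. -/
theorem measurable_comp_max {f : ℝ → ℝ} {A : ℝ} (hf : Measurable ((Ici A).domRestrict f)) :
    Measurable fun t => f (max t A) :=
  hf.comp (g := (Ici A).domRestrict f)
    (f := fun t : ℝ => (⟨max t A, le_max_right t A⟩ : Ici A))
    ((measurable_id.max measurable_const).subtype_mk)

/-- Potter's bounds: the logarithmic slope of a function in `RV(ϑ)` over `[t, s]` is `ϑ` up to an
arbitrarily small error. Since the bound is additive in `ε`, it also contains the uniform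
convergence theorem. -/
theorem IsRV.potter {f : ℝ → ℝ} {ϑ : ℝ} (hf : IsRV f ϑ) {ε : ℝ} (hε : 0 < ε) :
    ∃ T, 0 < T ∧ (∀ t, T ≤ t → 0 < f t) ∧ ∀ t, T ≤ t → ∀ s, t ≤ s →
      |Real.log (f s) - Real.log (f t) - ϑ * (Real.log s - Real.log t)| ≤
        ε * (Real.log s - Real.log t + 1) := by
  obtain ⟨⟨A, hpos, hmeas⟩, hlim⟩ := hf
  set h : ℝ → ℝ := fun x => Real.log (f (max (Real.exp x) A)) - ϑ * x with hh
  have hm : Measurable h :=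
    ((Real.measurable_log.comp ((measurable_comp_max hmeas).comp Real.measurable_exp))).sub
      (measurable_id.const_mul ϑ)
  have hs : ∀ u, Tendsto (fun x => h (x + u) - h x) atTop (𝓝 0) := by
    intro u
    have h1 := (hlim (Real.exp u) (Real.exp_pos u)).comp Real.tendsto_exp_atTop
    have h2 := (h1.log (Real.rpow_pos_of_pos (Real.exp_pos u) ϑ).ne').sub_const (ϑ * u)
    rw [Real.log_rpow (Real.exp_pos u), Real.log_exp, sub_self] at h2
    refine h2.congr' ?_
    filter_upwards [Real.tendsto_exp_atTop.eventually_ge_atTop A,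
      (Real.tendsto_exp_atTop.comp (tendsto_atTop_add_const_right atTop u
        tendsto_id)).eventually_ge_atTop A] with x hx hxu
    simp only [Function.comp, id] at hxu
    have e : Real.exp u * Real.exp x = Real.exp (x + u) := by rw [Real.exp_add]; ring
    simp only [Function.comp, hh, max_eq_left hx, max_eq_left hxu, e]
    rw [Real.log_div (hpos _ hxu).ne' (hpos _ hx).ne']
    ring
  obtain ⟨X, hX⟩ := exists_forall_abs_shift_le_mul hm hs hε
  refine ⟨max (Real.exp X) A, lt_max_of_lt_left (Real.exp_pos X),
    fun t ht => hpos t ((le_max_right _ _).trans ht), fun t ht s hts => ?_⟩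
  have ht0 : 0 < t := (Real.exp_pos X).trans_le ((le_max_left _ _).trans ht)
  have hs0 : 0 < s := ht0.trans_le hts
  have hXt : X ≤ Real.log t := (Real.le_log_iff_exp_le ht0).2 ((le_max_left _ _).trans ht)
  have hA : A ≤ t := (le_max_right _ _).trans ht
  have := hX (Real.log t) hXt (Real.log s - Real.log t)
    (sub_nonneg.2 (Real.log_le_log ht0 hts))
  simp only [hh, add_sub_cancel, Real.exp_log ht0, Real.exp_log hs0, max_eq_left hA,
    max_eq_left (hA.trans hts)] at this
  convert this using 2
  ring

/-! ### Calculus of regularly varying functions -/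

theorem measurable_domRestrict_Ici_mono {f : ℝ → ℝ} {A B : ℝ} (hAB : A ≤ B)
    (hf : Measurable ((Ici A).domRestrict f)) : Measurable ((Ici B).domRestrict f) :=
  hf.comp (g := (Ici A).domRestrict f)
    (f := fun t : Ici B => (⟨t, hAB.trans t.2⟩ : Ici A)) measurable_subtype_coe.subtype_mk

theorem measurable_domRestrict_of_continuousOn {f : ℝ → ℝ} {A : ℝ}
    (hf : ContinuousOn f (Ici A)) : Measurable ((Ici A).domRestrict f) :=
  (continuousOn_iff_continuous_domRestrict.1 hf).measurable

theorem tendsto_const_mul_atTop_self {l : ℝ} (hl : 0 < l) :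
    Tendsto (fun t : ℝ => l * t) atTop atTop :=
  tendsto_id.const_mul_atTop hl

theorem IsRV.eventually_pos {f : ℝ → ℝ} {ϑ : ℝ} (hf : IsRV f ϑ) : ∀ᶠ t in atTop, 0 < f t := by
  obtain ⟨⟨A, hpos, -⟩, -⟩ := hf
  filter_upwards [eventually_ge_atTop A] with t ht using hpos t ht

theorem IsRV.mul {f g : ℝ → ℝ} {ϑ η : ℝ} (hf : IsRV f ϑ) (hg : IsRV g η) :
    IsRV (fun t => f t * g t) (ϑ + η) := by
  obtain ⟨⟨A, hpos, hmeas⟩, hlim⟩ := hf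
  obtain ⟨⟨B, hpos', hmeas'⟩, hlim'⟩ := hg
  refine ⟨⟨max A B, fun t ht => mul_pos (hpos t ((le_max_left _ _).trans ht))
    (hpos' t ((le_max_right _ _).trans ht)), ?_⟩, fun l hl => ?_⟩
  · exact (measurable_domRestrict_Ici_mono (le_max_left _ _) hmeas).mul
      (measurable_domRestrict_Ici_mono (le_max_right _ _) hmeas')
  · rw [Real.rpow_add hl]
    exact ((hlim l hl).mul (hlim' l hl)).congr fun t => div_mul_div_comm _ _ _ _

theorem IsRV.rpow {f : ℝ → ℝ} {ϑ : ℝ} (hf : IsRV f ϑ) (c : ℝ) :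
    IsRV (fun t => f t ^ c) (ϑ * c) := by
  obtain ⟨⟨A, hpos, hmeas⟩, hlim⟩ := hf
  refine ⟨⟨A, fun t ht => Real.rpow_pos_of_pos (hpos t ht) c, hmeas.pow_const c⟩,
    fun l hl => ?_⟩
  rw [Real.rpow_mul hl.le]
  refine ((hlim l hl).rpow_const (Or.inl (Real.rpow_pos_of_pos hl ϑ).ne')).congr' ?_
  filter_upwards [eventually_ge_atTop A,
    (tendsto_const_mul_atTop_self hl).eventually_ge_atTop A] with t h1 h2
  rw [Real.div_rpow (hpos _ h2).le (hpos _ h1).le]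

theorem isRV_id : IsRV (fun t => t) 1 := by
  refine ⟨⟨1, fun t ht => by linarith, measurable_subtype_coe⟩, fun l hl => ?_⟩
  rw [Real.rpow_one]
  refine tendsto_const_nhds.congr' ?_
  filter_upwards [eventually_gt_atTop 0] with t ht
  field_simp

/-- Regular variation is inherited by asymptotically equivalent functions. -/
theorem IsRV.of_tendsto_div_one {f g : ℝ → ℝ} {ϑ A : ℝ} (hg : IsRV g ϑ)
    (hfc : ContinuousOn f (Ici A)) (hf : ∀ t, A ≤ t → 0 < f t)
    (h : Tendsto (fun t => f t / g t) atTop (𝓝 1)) : IsRV f ϑ := by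
  refine ⟨⟨A, hf, measurable_domRestrict_of_continuousOn hfc⟩, fun l hl => ?_⟩
  have h1 := ((h.comp (tendsto_const_mul_atTop_self hl)).mul (hg.2 l hl)).mul
    (h.inv₀ one_ne_zero)
  rw [one_mul, inv_one, mul_one] at h1
  refine h1.congr' ?_
  filter_upwards [hg.eventually_pos, (tendsto_const_mul_atTop_self hl).eventually hg.eventually_pos,
    eventually_ge_atTop A] with t h2 h3 h4
  have := hf t h4
  simp only [Function.comp]
  field_simp

theorem IsRV.tendsto_atTop {f : ℝ → ℝ} {ϑ : ℝ} (hf : IsRV f ϑ) (hϑ : 0 < ϑ) :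
    Tendsto f atTop atTop := by
  obtain ⟨T, hT, hpos, hb⟩ := hf.potter (half_pos hϑ)
  have h1 : Tendsto (fun s => Real.log (f T) + (ϑ / 2) * (Real.log s - Real.log T) - ϑ / 2)
      atTop atTop := by
    refine tendsto_atTop_add_const_right _ _ (tendsto_atTop_add_const_left _ _ ?_)
    exact (tendsto_atTop_add_const_right _ _ Real.tendsto_log_atTop).const_mul_atTop (half_pos hϑ)
  refine tendsto_atTop_mono' _ ?_ (Real.tendsto_exp_atTop.comp h1)
  filter_upwards [eventually_ge_atTop T] with s hs
  have := (abs_le.1 (hb T le_rfl s hs)).1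
  rw [Function.comp, ← Real.le_log_iff_exp_le (hpos s hs)]
  linarith

/-- A regularly varying function does not distinguish comparable arguments, up to the exact power. -/
theorem IsRV.tendsto_comp_div {f τ : ℝ → ℝ} {ϑ K : ℝ} (hf : IsRV f ϑ)
    (hτ_le : ∀ᶠ t in atTop, τ t ≤ t) (hτ : ∀ᶠ t in atTop, 0 < τ t ∧ t / τ t ≤ K)
    (hτ_top : Tendsto τ atTop atTop) :
    Tendsto (fun t => f (τ t) / f t * (t / τ t) ^ ϑ) atTop (𝓝 1) := by
  have key : Tendsto (fun t => Real.log (f t) - Real.log (f (τ t)) -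
      ϑ * (Real.log t - Real.log (τ t))) atTop (𝓝 0) := by
    rw [Metric.tendsto_nhds]
    intro ε hε
    have hD : 0 < |Real.log K| + 1 := by positivity
    obtain ⟨T, hT, hpos, hb⟩ := hf.potter (ε := ε / 2 / (|Real.log K| + 1)) (by positivity)
    filter_upwards [hτ_le, hτ, hτ_top.eventually_ge_atTop T] with t h1 h2 h3
    have h4 := hb (τ t) h3 t h1
    have ht : 0 < t := h2.1.trans_le h1
    have h5 : Real.log t - Real.log (τ t) ≤ |Real.log K| := by
      rw [← Real.log_div ht.ne' h2.1.ne']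
      exact (Real.log_le_log (div_pos ht h2.1) h2.2).trans (le_abs_self _)
    rw [Real.dist_eq, sub_zero]
    refine h4.trans_lt ?_
    calc _ ≤ ε / 2 / (|Real.log K| + 1) * (|Real.log K| + 1) := by gcongr
      _ = ε / 2 := by field_simp
      _ < ε := by linarith
  have h1 := (Real.continuous_exp.tendsto _).comp key.neg
  rw [neg_zero, Real.exp_zero] at h1
  refine h1.congr' ?_
  filter_upwards [hτ_le, hτ, hf.eventually_pos, hτ_top.eventually hf.eventually_pos]
    with t h1 h2 h3 h4
  have ht : 0 < t := h2.1.trans_le h1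
  have : (0 : ℝ) < f (τ t) / f t * (t / τ t) ^ ϑ :=
    mul_pos (div_pos h4 h3) (Real.rpow_pos_of_pos (div_pos ht h2.1) _)
  rw [Function.comp, ← Real.exp_log this, Real.log_mul (div_pos h4 h3).ne'
    (Real.rpow_pos_of_pos (div_pos ht h2.1) _).ne', Real.log_div h4.ne' h3.ne',
    Real.log_rpow (div_pos ht h2.1), Real.log_div ht.ne' h2.1.ne']
  congr 1
  ring

/-! ### Karamata's theorem and normalized regular variation -/

/-- Karamata's theorem, direct half: a primitive of `f ∈ RV(σ)`, `σ > -1`, behaves like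
`t f(t) / (σ + 1)`. Potter's bound dominates `f(ut) / f(t)` on `(T/t, 1]`. -/
theorem IsRV.tendsto_primitive_div {f F : ℝ → ℝ} {σ A : ℝ} (hf : IsRV f σ) (hσ : -1 < σ)
    (hc : ContinuousOn f (Ici A)) (hF : ∀ t, A ≤ t → HasDerivAt F (f t) t) :
    Tendsto (fun t => F t / (t * f t)) atTop (𝓝 (1 / (σ + 1))) := by
  have hε : 0 < (σ + 1) / 2 := by linarith
  obtain ⟨T', hT', hpos', hb'⟩ := hf.potter hε
  obtain ⟨T, hT, hAT, hpos, hb⟩ : ∃ T, 0 < T ∧ A ≤ T ∧ (∀ t, T ≤ t → 0 < f t) ∧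
      ∀ t, T ≤ t → ∀ s, t ≤ s →
      |Real.log (f s) - Real.log (f t) - σ * (Real.log s - Real.log t)| ≤
        (σ + 1) / 2 * (Real.log s - Real.log t + 1) :=
    ⟨max T' A, lt_max_of_lt_left hT', le_max_right _ _,
      fun t ht => hpos' t ((le_max_left _ _).trans ht),
      fun t ht => hb' t ((le_max_left _ _).trans ht)⟩
  have hcT : ContinuousOn f (Ici T) := hc.mono (Ici_subset_Ici.2 hAT)
  set f₁ : ℝ → ℝ := (Ioi T).indicator f with hf₁
  have f₁m : Measurable f₁ := by
    have : f₁ = (Ioi T).indicator fun t => f (max t T) := by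
      ext t
      by_cases ht : t ∈ Ioi T
      · simp [hf₁, ht, max_eq_left (le_of_lt (mem_Ioi.1 ht))]
      · simp [hf₁, ht]
    rw [this]
    exact (measurable_comp_max (measurable_domRestrict_of_continuousOn hcT)).indicator
      measurableSet_Ioi
  have main : Tendsto (fun t => ∫ u in (0 : ℝ)..1, f₁ (u * t) / f t) atTop
      (𝓝 (∫ u in (0 : ℝ)..1, u ^ σ)) := by
    refine intervalIntegral.tendsto_integral_filter_of_dominated_convergence
      (fun u => Real.exp ((σ + 1) / 2) * u ^ (σ - (σ + 1) / 2)) ?_ ?_ ?_ ?_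
    · exact Eventually.of_forall fun t =>
        ((f₁m.comp (measurable_mul_const t)).div_const _).aestronglyMeasurable
    · filter_upwards [eventually_ge_atTop T] with t ht
      refine Eventually.of_forall fun u hu => ?_
      rw [uIoc_of_le zero_le_one] at hu
      have hu0 : 0 < u := hu.1
      by_cases h : T < u * t
      · have hut : u * t ≤ t := by nlinarith [hu.2]
        have h1 := (abs_le.1 (hb (u * t) h.le t hut)).1
        have e : f₁ (u * t) = f (u * t) := by simp [hf₁, h]
        have p1 := hpos _ h.le
        have p2 := hpos _ ht
        rw [e, Real.norm_of_nonneg (div_pos p1 p2).le, ← Real.log_le_log_iff (div_pos p1 p2)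
          (by positivity), Real.log_mul (Real.exp_pos _).ne' (by positivity), Real.log_exp,
          Real.log_rpow hu0, Real.log_div p1.ne' p2.ne']
        rw [Real.log_mul hu0.ne' (hT.trans_le ht).ne'] at h1
        linarith
      · have e : f₁ (u * t) = 0 := by simp [hf₁, h]
        rw [e, zero_div, norm_zero]
        positivity
    · exact (intervalIntegral.intervalIntegrable_rpow' (by linarith)).const_mul _
    · refine Eventually.of_forall fun u hu => ?_
      rw [uIoc_of_le zero_le_one] at hu
      refine (hf.2 u hu.1).congr' ?_
      filter_upwards [(tendsto_const_mul_atTop_self hu.1).eventually_gt_atTop T] with t ht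
      simp [hf₁, ht]
  rw [integral_rpow (Or.inl hσ), Real.one_rpow, Real.zero_rpow (by linarith), sub_zero] at main
  have htf : Tendsto (fun t => t * f t) atTop atTop :=
    (isRV_id.mul hf).tendsto_atTop (by linarith)
  have hconst : Tendsto (fun t => F T / (t * f t)) atTop (𝓝 0) := htf.const_div_atTop _
  have := hconst.add main
  rw [zero_add] at this
  refine this.congr' ?_
  filter_upwards [eventually_gt_atTop T] with t ht
  have ht0 : 0 < t := hT.trans ht
  have FT : ∫ s in T..t, f s = F t - F T :=
    intervalIntegral.integral_eq_sub_of_hasDerivAt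
      (fun x hx => by
        rw [uIcc_of_le ht.le] at hx
        exact hF x (hAT.trans hx.1))
      (ContinuousOn.intervalIntegrable (hcT.mono (by
        rw [uIcc_of_le ht.le]; exact Icc_subset_Ici_self)))
  have e1 : ∫ u in (0 : ℝ)..1, f₁ (u * t) / f t = (F t - F T) / (t * f t) := by
    rw [intervalIntegral.integral_div, intervalIntegral.integral_comp_mul_right _ ht0.ne',
      zero_mul, one_mul, intervalIntegral.integral_of_le ht0.le, hf₁,
      setIntegral_indicator measurableSet_Ioi]
    have : Ioc 0 t ∩ Ioi T = Ioc T t := by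
      ext x
      simp only [mem_inter_iff, mem_Ioc, mem_Ioi]
      exact ⟨fun h => ⟨h.2, h.1.2⟩, fun h => ⟨⟨hT.trans h.1, h.2⟩, h.1⟩⟩
    rw [this, ← intervalIntegral.integral_of_le ht.le, FT, smul_eq_mul]
    have := hpos t ht.le
    field_simp
  rw [e1]
  ring

/-- Increments of a primitive over intervals of fixed ratio, with no restriction on the index. For
`σ = -1` the limit is `log l`. -/
theorem IsRV.tendsto_increment_div {f F : ℝ → ℝ} {σ A l : ℝ} (hf : IsRV f σ)
    (hc : ContinuousOn f (Ici A)) (hF : ∀ t, A ≤ t → HasDerivAt F (f t) t) (hl : 0 < l) :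
    Tendsto (fun t => (F (l * t) - F t) / (t * f t)) atTop (𝓝 (∫ u in (1 : ℝ)..l, u ^ σ)) := by
  obtain ⟨T, hT, hpos, hb⟩ := hf.potter one_pos
  have hm : 0 < min 1 l := lt_min one_pos hl
  have hu0 : ∀ u ∈ uIcc 1 l, 0 < u := fun u hu => hm.trans_le hu.1
  have hlarge := (tendsto_const_mul_atTop_self hm).eventually_ge_atTop (max T A)
  have hlarge' : ∀ t, 0 < t → max T A ≤ min 1 l * t → ∀ u ∈ uIcc 1 l, T ≤ u * t ∧ A ≤ u * t :=
    fun t ht0 ht u hu => by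
      have : min 1 l * t ≤ u * t := mul_le_mul_of_nonneg_right hu.1 ht0.le
      exact ⟨((le_max_left _ _).trans ht).trans this, ((le_max_right _ _).trans ht).trans this⟩
  have main : Tendsto (fun t => ∫ u in (1 : ℝ)..l, f (u * t) / f t) atTop
      (𝓝 (∫ u in (1 : ℝ)..l, u ^ σ)) := by
    refine intervalIntegral.tendsto_integral_filter_of_dominated_convergence
      (fun u => Real.exp (σ * Real.log u + (|Real.log u| + 1))) ?_ ?_ ?_ ?_
    · filter_upwards [eventually_gt_atTop 0, hlarge] with t ht0 ht
      refine ContinuousOn.aestronglyMeasurable ?_ measurableSet_uIoc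
      refine (hc.comp (continuousOn_id.mul continuousOn_const) fun u hu => ?_).div_const _
      exact (hlarge' t ht0 ht u (uIoc_subset_uIcc hu)).2
    · filter_upwards [eventually_gt_atTop 0, hlarge] with t ht0 ht
      refine Eventually.of_forall fun u hu => ?_
      have hu' := uIoc_subset_uIcc hu
      have hu1 := (hlarge' t ht0 ht u hu').1
      have h1u := (hlarge' t ht0 ht 1 left_mem_uIcc).1
      rw [one_mul] at h1u
      have p1 := hpos _ hu1
      have p2 := hpos _ h1u
      rw [Real.norm_of_nonneg (div_pos p1 p2).le, ← Real.log_le_iff_le_exp (div_pos p1 p2),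
        Real.log_div p1.ne' p2.ne']
      have hlog : Real.log (u * t) = Real.log u + Real.log t :=
        Real.log_mul (hu0 u hu').ne' ht0.ne'
      rcases le_total 1 u with h | h
      · have := (abs_le.1 (hb t h1u (u * t) (by nlinarith))).2
        rw [hlog] at this
        linarith [le_abs_self (Real.log u)]
      · have := (abs_le.1 (hb (u * t) hu1 t (by nlinarith))).1
        rw [hlog] at this
        linarith [neg_abs_le (Real.log u)]
    · refine ContinuousOn.intervalIntegrable ?_
      have hlog : ContinuousOn Real.log (uIcc 1 l) := fun u hu =>
        (Real.continuousAt_log (hu0 u hu).ne').continuousWithinAt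
      exact Real.continuous_exp.comp_continuousOn
        ((continuousOn_const.mul hlog).add (hlog.abs.add continuousOn_const))
    · exact Eventually.of_forall fun u hu => hf.2 u (hu0 u (uIoc_subset_uIcc hu))
  refine main.congr' ?_
  filter_upwards [eventually_gt_atTop 0, hlarge] with t ht0 ht
  have hsub : uIcc t (l * t) ⊆ Ici A := by
    intro x hx
    have h1 : x / t ∈ uIcc 1 l := by
      refine ⟨(le_div_iff₀ ht0).2 ?_, (div_le_iff₀ ht0).2 ?_⟩
      · rw [min_mul_of_nonneg _ _ ht0.le, one_mul]
        exact hx.1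
      · rw [max_mul_of_nonneg _ _ ht0.le, one_mul]
        exact hx.2
    have := (hlarge' t ht0 ht _ h1).2
    rwa [div_mul_cancel₀ _ ht0.ne'] at this
  have hI : ∫ s in t..l * t, f s = F (l * t) - F t :=
    intervalIntegral.integral_eq_sub_of_hasDerivAt (fun x hx => hF x (hsub hx))
      (ContinuousOn.intervalIntegrable (hc.mono hsub))
  rw [intervalIntegral.integral_div, intervalIntegral.integral_comp_mul_right _ ht0.ne',
    one_mul, hI, smul_eq_mul, div_mul_eq_div_div, inv_mul_eq_div]

theorem continuous_comp_max {f : ℝ → ℝ} {A : ℝ} (hf : ContinuousOn f (Ici A)) :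
    Continuous fun t => f (max t A) :=
  hf.comp_continuous (continuous_id.max continuous_const) fun t => le_max_right t A

theorem tendsto_comp_max {f : ℝ → ℝ} {A : ℝ} {l : Filter ℝ} (hf : Tendsto f atTop l) :
    Tendsto (fun t => f (max t A)) atTop l :=
  hf.congr' (by
    filter_upwards [eventually_ge_atTop A] with t ht
    rw [max_eq_left ht])

/-- A positive `C¹` function whose elasticity `t F'(t) / F(t)` tends to `ϑ` is in `NRV(ϑ)`. -/
theorem isNRV_of_tendsto_elasticity {F F' : ℝ → ℝ} {ϑ A : ℝ}
    (hF : ∀ t, A ≤ t → HasDerivAt F (F' t) t) (hpos : ∀ t, A ≤ t → 0 < F t)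
    (hc : ContinuousOn F' (Ici A)) (h : Tendsto (fun t => t * F' t / F t) atTop (𝓝 ϑ)) :
    IsNRV F ϑ := by
  set B := max A 1
  have hB : 0 < B := lt_max_of_lt_right one_pos
  have hAB : A ≤ B := le_max_left _ _
  have hφc : ContinuousOn (fun t => t * F' t / F t - ϑ) (Ici B) := by
    refine ((continuousOn_id.mul (hc.mono (Ici_subset_Ici.2 hAB))).div
      (fun t ht => (hF t (hAB.trans ht)).continuousAt.continuousWithinAt) fun t ht =>
        (hpos t (hAB.trans ht)).ne').sub continuousOn_const
  have hφ0 : Tendsto (fun t => t * F' t / F t - ϑ) atTop (𝓝 0) := by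
    simpa using h.sub_const ϑ
  set ψ : ℝ → ℝ := fun s => (fun t => t * F' t / F t - ϑ) (max s B) with hψ
  have hψc : Continuous ψ := continuous_comp_max hφc
  have hint : ∀ t, B ≤ t → IntervalIntegrable (fun s => ψ s / s) volume B t := fun t ht =>
    ContinuousOn.intervalIntegrable (hψc.continuousOn.div continuousOn_id fun s hs => by
      rw [uIcc_of_le ht] at hs
      exact (hB.trans_le hs.1).ne')
  refine ⟨B, F B * B ^ (-ϑ), ψ, hB, mul_pos (hpos B hAB) (Real.rpow_pos_of_pos hB _),
    hψc.measurable, tendsto_comp_max hφ0, hint, fun t ht => ?_⟩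
  have ht0 : 0 < t := hB.trans_le ht
  have hI : ∫ s in B..t, ψ s / s =
      (Real.log (F t) - ϑ * Real.log t) - (Real.log (F B) - ϑ * Real.log B) := by
    refine intervalIntegral.integral_eq_sub_of_hasDerivAt
      (f := fun s => Real.log (F s) - ϑ * Real.log s) (fun s hs => ?_) (hint t ht)
    rw [uIcc_of_le ht] at hs
    have hs0 : 0 < s := hB.trans_le hs.1
    have hFs := hpos s (hAB.trans hs.1)
    have := ((hF s (hAB.trans hs.1)).log hFs.ne').sub
      ((Real.hasDerivAt_log hs0.ne').const_mul ϑ)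
    have e : ψ s / s = F' s / F s - ϑ * s⁻¹ := by
      show (max s B * F' (max s B) / F (max s B) - ϑ) / s = _
      rw [max_eq_left hs.1]
      field_simp
    rw [e]
    exact this
  obtain ⟨b, hb⟩ : ∃ b, F B = Real.exp b := ⟨_, (Real.exp_log (hpos B hAB)).symm⟩
  obtain ⟨c, hc'⟩ : ∃ c, F t = Real.exp c := ⟨_, (Real.exp_log (hpos t (hAB.trans ht))).symm⟩
  rw [hI, Real.rpow_def_of_pos hB, Real.rpow_def_of_pos ht0, hb, hc', Real.log_exp, Real.log_exp,
    ← Real.exp_add, ← Real.exp_add, ← Real.exp_add]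
  congr 1
  ring

theorem IsNRV.isRV {f : ℝ → ℝ} {ϑ : ℝ} (hf : IsNRV f ϑ) : IsRV f ϑ := by
  obtain ⟨t₁, C, ψ, ht₁, hC, -, hψ, hint, hrep⟩ := hf
  have hpos : ∀ t, t₁ ≤ t → 0 < f t := fun t ht => by
    rw [hrep t ht]
    have := Real.rpow_pos_of_pos (ht₁.trans_le ht) ϑ
    positivity
  have hcont : ContinuousOn f (Ici t₁) := by
    have hP : ContinuousOn (fun t => ∫ s in t₁..t, ψ s / s) (Ici t₁) := by
      intro t ht
      have hlt : t < t + 1 := lt_add_one t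
      have := intervalIntegral.continuousOn_primitive_interval' (hint (t + 1)
        ((mem_Ici.1 ht).trans hlt.le)) left_mem_uIcc
      rw [uIcc_of_le ((mem_Ici.1 ht).trans hlt.le)] at this
      refine (this t ⟨ht, hlt.le⟩).mono_of_mem_nhdsWithin ?_
      rw [mem_nhdsWithin_iff_exists_mem_nhds_inter]
      exact ⟨Iio (t + 1), Iio_mem_nhds hlt, fun x hx => ⟨hx.2, (mem_Iio.1 hx.1).le⟩⟩
    exact ((continuousOn_const.mul (continuousOn_id.rpow_const fun t ht =>
      Or.inl (ht₁.trans_le ht).ne')).mul (Real.continuous_exp.comp_continuousOn hP)).congr hrep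
  refine ⟨⟨t₁, hpos, measurable_domRestrict_of_continuousOn hcont⟩, fun l hl => ?_⟩
  have hm : 0 < min 1 l := lt_min one_pos hl
  have key : Tendsto (fun t => ∫ s in t..l * t, ψ s / s) atTop (𝓝 0) := by
    rw [Metric.tendsto_nhds]
    intro ε hε
    have hη : 0 < ε * min 1 l / (|l - 1| + 1) := by positivity
    obtain ⟨X, hX⟩ := eventually_atTop.1 ((Metric.tendsto_nhds.1 hψ) _ hη)
    filter_upwards [eventually_gt_atTop 0, (tendsto_const_mul_atTop_self hm).eventually_ge_atTop X]
      with t ht htX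
    rw [dist_zero_right]
    have hmt : 0 < min 1 l * t := mul_pos hm ht
    have hb := intervalIntegral.norm_integral_le_of_norm_le_const (a := t) (b := l * t)
      (f := fun s => ψ s / s) (C := ε * min 1 l / (|l - 1| + 1) / (min 1 l * t)) (fun s hs => by
        have hs' : min 1 l * t ≤ s := by
          have h1 : min t (l * t) < s := hs.1
          refine le_trans ?_ h1.le
          rw [le_min_iff]
          constructor
          · nlinarith [min_le_left 1 l]
          · nlinarith [min_le_right 1 l]
        have h2 := hX s (htX.trans hs')
        rw [dist_zero_right] at h2
        rw [norm_div, Real.norm_of_nonneg (hmt.trans_le hs').le]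
        gcongr)
    refine hb.trans_lt ?_
    have e : |l * t - t| = |l - 1| * t := by
      rw [← abs_of_pos ht, ← abs_mul, abs_of_pos ht]; ring_nf
    rw [e]
    have : ε * min 1 l / (|l - 1| + 1) / (min 1 l * t) * (|l - 1| * t) =
        ε * (|l - 1| / (|l - 1| + 1)) := by field_simp
    rw [this]
    have : |l - 1| / (|l - 1| + 1) < 1 := by rw [div_lt_one (by positivity)]; linarith
    nlinarith
  have h1 := ((Real.continuous_exp.tendsto _).comp key).const_mul (l ^ ϑ)
  rw [Real.exp_zero, mul_one] at h1
  refine h1.congr' ?_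
  filter_upwards [eventually_ge_atTop t₁,
    (tendsto_const_mul_atTop_self hl).eventually_ge_atTop t₁] with t h2 h3
  have e := intervalIntegral.integral_interval_sub_left (hint _ h3) (hint _ h2)
  simp only [Function.comp]
  rw [← e, hrep t h2, hrep _ h3, Real.exp_sub, Real.mul_rpow hl.le (ht₁.trans_le h2).le]
  have := Real.rpow_pos_of_pos (ht₁.trans_le h2) ϑ
  field_simp

variable {α β δ a : ℝ} {r p τ y : ℝ → ℝ}

/-! ### The equation and its increasing solutions -/

/-- The standing hypotheses on the equation `(r Φ(y'))' = p Φ(y ∘ τ)`, with the exponents entering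
through `(α - 1) (β - 1) = 1`. -/
structure IsRVDelayEquation (α β δ a : ℝ) (r p τ : ℝ → ℝ) : Prop where
  one_lt : 1 < α
  conj : (α - 1) * (β - 1) = 1
  lt_neg_one : δ < -1
  continuousOn_r : ContinuousOn r (Ici a)
  r_pos : ∀ t, a ≤ t → 0 < r t
  continuousOn_p : ContinuousOn p (Ici a)
  p_pos : ∀ t, a ≤ t → 0 < p t
  contDiffOn_delay : ContDiffOn ℝ 1 τ (Ici a)
  tauDeriv_pos : ∀ t, a ≤ t → 0 < tauDeriv a τ t
  delay_le : ∀ t, a ≤ t → τ t ≤ t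
  delay_bound : ∃ K : ℝ, ∀ᶠ t in atTop, 0 < τ t ∧ t / τ t ≤ K
  isRV_p : IsRV p δ
  isRV_r : IsRV r (δ + α)
  isRV_delay : IsRV (fun t => r (τ t) ^ (1 - β) * tauDeriv a τ t) (δ * (1 - β) - β)
  tendsto_svPart : Tendsto
    (fun t => (svPart p δ t / svPart r (δ + α) t) ^ (β - 1) * tauDeriv a τ t) atTop (𝓝 0)

theorem Phi_of_pos {u : ℝ} (hu : 0 < u) : Phi α u = u ^ (α - 1) := by
  simp [Phi, abs_of_pos hu, Real.sign_of_pos hu]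

theorem pos_of_Phi_pos {u : ℝ} (hu : 0 < Phi α u) : 0 < u := by
  by_contra! h
  rcases h.lt_or_eq with h | h
  · have := Real.rpow_nonneg (abs_nonneg u) (α - 1)
    rw [Phi, Real.sign_of_neg h] at hu
    linarith
  · simp [Phi, h] at hu

theorem neg_of_Phi_neg {u : ℝ} (hu : Phi α u < 0) : u < 0 := by
  by_contra! h
  rcases h.lt_or_eq with h | h
  · rw [Phi_of_pos h] at hu
    exact absurd hu (not_lt.2 (Real.rpow_nonneg h.le _))
  · simp [Phi, ← h] at hu

namespace IsRVDelayEquation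

theorem sub_one_pos (E : IsRVDelayEquation α β δ a r p τ) : 0 < α - 1 := sub_pos.2 E.one_lt

theorem conj_sub_one_pos (E : IsRVDelayEquation α β δ a r p τ) : 0 < β - 1 :=
  pos_of_mul_pos_right (E.conj.symm ▸ one_pos) E.sub_one_pos.le

theorem rvIndex_eq (E : IsRVDelayEquation α β δ a r p τ) :
    rvIndex α δ = (-1 - δ) * (β - 1) := by
  have := E.sub_one_pos
  rw [rvIndex, div_eq_iff this.ne', mul_assoc, mul_comm (β - 1), E.conj, mul_one]

theorem rvIndex_mul (E : IsRVDelayEquation α β δ a r p τ) :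
    rvIndex α δ * (α - 1) = -1 - δ :=
  div_mul_cancel₀ _ E.sub_one_pos.ne'

theorem rvIndex_pos (E : IsRVDelayEquation α β δ a r p τ) : 0 < rvIndex α δ :=
  div_pos (by linarith [E.lt_neg_one]) E.sub_one_pos

theorem tendsto_delay (E : IsRVDelayEquation α β δ a r p τ) : Tendsto τ atTop atTop := by
  obtain ⟨K, hK⟩ := E.delay_bound
  have hK' : (0 : ℝ) < max K 1 := lt_max_of_lt_right one_pos
  refine tendsto_atTop_mono' _ ?_ (tendsto_id.atTop_div_const hK')
  filter_upwards [hK] with t ht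
  rw [div_le_iff₀ ht.1] at ht
  rw [id, div_le_iff₀ hK']
  nlinarith [le_max_left K 1, ht.1]

theorem hasDerivAt_delay (E : IsRVDelayEquation α β δ a r p τ) {t : ℝ} (ht : a < t) :
    HasDerivAt τ (tauDeriv a τ t) t :=
  ((E.contDiffOn_delay.differentiableOn one_ne_zero) t ht.le).hasDerivWithinAt.hasDerivAt
    (Ici_mem_nhds ht)

theorem continuousOn_tauDeriv (E : IsRVDelayEquation α β δ a r p τ) :
    ContinuousOn (tauDeriv a τ) (Ici a) :=
  E.contDiffOn_delay.continuousOn_derivWithin (uniqueDiffOn_Ici a) le_rfl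

theorem monotoneOn_delay (E : IsRVDelayEquation α β δ a r p τ) : MonotoneOn τ (Ici a) := by
  refine monotoneOn_of_deriv_nonneg (convex_Ici a) E.contDiffOn_delay.continuousOn ?_ ?_
  · rw [interior_Ici]
    exact fun t ht => (E.hasDerivAt_delay ht).differentiableAt.differentiableWithinAt
  · rw [interior_Ici]
    intro t ht
    rw [(E.hasDerivAt_delay ht).deriv]
    exact (E.tauDeriv_pos t (le_of_lt ht)).le

theorem continuousOn_comp_delay (E : IsRVDelayEquation α β δ a r p τ) {f : ℝ → ℝ} {B t₀ : ℝ}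
    (hf : ContinuousOn f (Ici B)) (ha : a ≤ t₀) (hτ : ∀ t, t₀ ≤ t → B ≤ τ t) :
    ContinuousOn (fun t => f (τ t)) (Ici t₀) :=
  hf.comp (E.contDiffOn_delay.continuousOn.mono (Ici_subset_Ici.2 ha)) hτ

theorem continuousOn_delayed_weight (E : IsRVDelayEquation α β δ a r p τ) {t₀ : ℝ}
    (ha : a ≤ t₀) (hτ : ∀ t, t₀ ≤ t → a ≤ τ t) :
    ContinuousOn (fun t => r (τ t) ^ (1 - β) * tauDeriv a τ t) (Ici t₀) :=
  ((E.continuousOn_comp_delay E.continuousOn_r ha hτ).rpow_const fun t ht =>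
    Or.inl (E.r_pos _ (hτ t ht)).ne').mul (E.continuousOn_tauDeriv.mono (Ici_subset_Ici.2 ha))

theorem Htau_eq (E : IsRVDelayEquation α β δ a r p τ) {t : ℝ} (ht : a ≤ t) (h0 : 0 ≤ t)
    (hτ : a ≤ τ t) :
    Htau α a r p τ t =
      p t * (t * (r (τ t) ^ (1 - β) * tauDeriv a τ t)) ^ (α - 1) := by
  have h1 := E.tauDeriv_pos t ht
  have h2 := E.r_pos _ hτ
  have e : (1 - β) * (α - 1) = -1 := by linarith [E.conj]
  rw [Htau, mul_left_comm, Real.mul_rpow (Real.rpow_nonneg h2.le _) (by positivity),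
    ← Real.rpow_mul h2.le, e, Real.rpow_neg_one]
  field_simp

theorem continuousOn_Htau (E : IsRVDelayEquation α β δ a r p τ) {t₀ : ℝ}
    (ha : a ≤ t₀) (hτ : ∀ t, t₀ ≤ t → a ≤ τ t) :
    ContinuousOn (Htau α a r p τ) (Ici t₀) := by
  have hs : Ici t₀ ⊆ Ici a := Ici_subset_Ici.2 ha
  exact ((continuousOn_id.mul (E.continuousOn_tauDeriv.mono hs)).rpow_const fun t _ =>
    Or.inr E.sub_one_pos.le).mul ((E.continuousOn_p.mono hs).div
      (E.continuousOn_comp_delay E.continuousOn_r ha hτ) fun t ht => (E.r_pos _ (hτ t ht)).ne')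

theorem Htau_pos (E : IsRVDelayEquation α β δ a r p τ) {t : ℝ} (ht : a ≤ t) (h0 : 0 < t)
    (hτ : a ≤ τ t) : 0 < Htau α a r p τ t :=
  mul_pos (Real.rpow_pos_of_pos (mul_pos h0 (E.tauDeriv_pos t ht)) _)
    (div_pos (E.p_pos t ht) (E.r_pos _ hτ))

theorem tendsto_r_delay (E : IsRVDelayEquation α β δ a r p τ) :
    Tendsto (fun t => r (τ t) / r t * (t / τ t) ^ (δ + α)) atTop (𝓝 1) := by
  obtain ⟨K, hK⟩ := E.delay_bound
  exact E.isRV_r.tendsto_comp_div ((eventually_ge_atTop a).mono E.delay_le) hK E.tendsto_delay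

/-- `t H_τ(t)` is the power `α - 1` of the expression in `tendsto_svPart`, times `r / (r ∘ τ)`, which
is bounded because `t / τ(t)` is. -/
theorem tendsto_mul_Htau (E : IsRVDelayEquation α β δ a r p τ) :
    Tendsto (fun t => t * Htau α a r p τ t) atTop (𝓝 0) := by
  obtain ⟨K, hK⟩ := E.delay_bound
  have h1 := E.tendsto_svPart.rpow_const (p := α - 1) (Or.inr E.sub_one_pos.le)
  rw [Real.zero_rpow E.sub_one_pos.ne'] at h1
  have h2 := (h1.mul (E.tendsto_r_delay.inv₀ one_ne_zero)).mul_const (max K 1 ^ |δ + α|)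
  rw [zero_mul, zero_mul] at h2
  refine squeeze_zero' ?_ ?_ h2
  · filter_upwards [eventually_gt_atTop 0, eventually_ge_atTop a,
      E.tendsto_delay.eventually_ge_atTop a] with t h3 h4 h5
    exact (mul_pos h3 (E.Htau_pos h4 h3 h5)).le
  · filter_upwards [eventually_gt_atTop 0, eventually_ge_atTop a,
      E.tendsto_delay.eventually_ge_atTop a, hK] with t ht ha hτa hτ
    have hr := E.r_pos t ha
    have hrτ := E.r_pos _ hτa
    have hp := E.p_pos t ha
    have hd := E.tauDeriv_pos t ha
    have hq : 1 ≤ t / τ t := (one_le_div hτ.1).2 (E.delay_le t ha)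
    have hq0 : 0 < t / τ t := one_pos.trans_le hq
    have hX : 0 < (t / τ t) ^ (δ + α) := Real.rpow_pos_of_pos hq0 _
    have hsv : svPart p δ t / svPart r (δ + α) t = t ^ α * p t / r t := by
      have := Real.rpow_pos_of_pos ht δ
      have := Real.rpow_pos_of_pos ht α
      rw [svPart, svPart, Real.rpow_add ht]
      field_simp
    have hpow : ((svPart p δ t / svPart r (δ + α) t) ^ (β - 1) * tauDeriv a τ t) ^ (α - 1) =
        t ^ α * p t / r t * tauDeriv a τ t ^ (α - 1) := by
      have : 0 < t ^ α * p t / r t := by positivity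
      rw [hsv, Real.mul_rpow (by positivity) hd.le, ← Real.rpow_mul this.le,
        mul_comm (β - 1), E.conj, Real.rpow_one]
    have hH : t * Htau α a r p τ t = t ^ α * p t / r t * tauDeriv a τ t ^ (α - 1) *
        (r (τ t) / r t * (t / τ t) ^ (δ + α))⁻¹ * (t / τ t) ^ (δ + α) := by
      have : t ^ α = t * t ^ (α - 1) := by
        rw [Real.rpow_sub_one ht.ne']; field_simp
      rw [Htau, Real.mul_rpow ht.le hd.le, this]
      field_simp
    rw [hpow, hH]
    have : 0 < tauDeriv a τ t ^ (α - 1) := Real.rpow_pos_of_pos hd _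
    refine mul_le_mul_of_nonneg_left ?_ (by positivity)
    calc (t / τ t) ^ (δ + α) ≤ (t / τ t) ^ |δ + α| :=
          Real.rpow_le_rpow_of_exponent_le hq (le_abs_self _)
      _ ≤ max K 1 ^ |δ + α| :=
          Real.rpow_le_rpow hq0.le (hτ.2.trans (le_max_left _ _)) (abs_nonneg _)

end IsRVDelayEquation

/-- On `[T, ∞)`, `y` is a positive increasing solution, and everything the equation involves at `t`
and at `τ t` is positive and differentiable. The derivative of `y` is expressed through the
quasiderivative `q`, by inverting `q = r Φ(y')`. -/
structure IsGrowingFrom (α β a : ℝ) (r p τ y q : ℝ → ℝ) (T : ℝ) : Prop where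
  a_lt : a < T
  T_pos : 0 < T
  a_lt_delay : ∀ t, T ≤ t → a < τ t
  delay_pos : ∀ t, T ≤ t → 0 < τ t
  pos : ∀ t, T ≤ t → 0 < y t
  pos_delay : ∀ t, T ≤ t → 0 < y (τ t)
  q_pos : ∀ t, T ≤ t → 0 < q t
  q_pos_delay : ∀ t, T ≤ t → 0 < q (τ t)
  q_mono : MonotoneOn q (Ici T)
  q_delay_le : ∀ t, T ≤ t → q (τ t) ≤ q t
  continuousAt_q_delay : ∀ t, T ≤ t → ContinuousAt q (τ t)
  hasDerivAt : ∀ t, T ≤ t → HasDerivAt y (q t ^ (β - 1) * r t ^ (1 - β)) t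
  hasDerivAt_delay : ∀ t, T ≤ t → HasDerivAt (fun t => y (τ t))
    (q (τ t) ^ (β - 1) * (r (τ t) ^ (1 - β) * tauDeriv a τ t)) t
  hasDerivAt_q : ∀ t, T ≤ t → HasDerivAt q (p t * y (τ t) ^ (α - 1)) t

namespace IsRVDelayEquation

/-- The quasiderivative of an eventually positive solution is eventually strictly increasing. -/
theorem exists_strictMonoOn_quasiDeriv (E : IsRVDelayEquation α β δ a r p τ) {T₀ : ℝ}
    (ha : a ≤ T₀) (hpos : ∀ t, T₀ < t → 0 < y t)
    (hd : ∀ t, T₀ < t → HasDerivAt (quasiDeriv α r y) (p t * Phi α (y (τ t))) t) :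
    ∃ T, T₀ < T ∧ (∀ t, T ≤ t → T₀ < τ t) ∧ StrictMonoOn (quasiDeriv α r y) (Ici T) := by
  obtain ⟨B, hB⟩ := eventually_atTop.1 (E.tendsto_delay.eventually_gt_atTop T₀)
  refine ⟨max B (T₀ + 1), (lt_add_one T₀).trans_le (le_max_right _ _),
    fun t ht => hB t ((le_max_left _ _).trans ht), ?_⟩
  have hT : ∀ t, max B (T₀ + 1) ≤ t → T₀ < t := fun t ht =>
    (lt_add_one T₀).trans_le ((le_max_right _ _).trans ht)
  refine strictMonoOn_of_deriv_pos (convex_Ici _)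
    (fun t ht => (hd t (hT t ht)).continuousAt.continuousWithinAt) fun t ht => ?_
  rw [interior_Ici] at ht
  have ht' := le_of_lt (mem_Ioi.1 ht)
  have hy := hpos _ (hB t ((le_max_left _ _).trans ht'))
  rw [(hd t (hT t ht')).deriv, Phi_of_pos hy]
  exact mul_pos (E.p_pos t (ha.trans (hT t ht').le)) (Real.rpow_pos_of_pos hy _)

/-- The quasiderivative of a solution has a constant sign for large `t`; if it were negative, the
solution would be bounded. -/
theorem mem_IS_of_tendsto_atTop (E : IsRVDelayEquation α β δ a r p τ) (hy : y ∈ Sol α a r p τ)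
    (hinf : Tendsto y atTop atTop) : y ∈ IS α a r p τ := by
  refine ⟨hy, ?_⟩
  obtain ⟨T₀, ha, hpos, hC, -, hd⟩ := hy
  obtain ⟨T, hT, -, hmono⟩ := E.exists_strictMonoOn_quasiDeriv ha hpos hd
  by_cases h : ∃ t₁, T ≤ t₁ ∧ 0 ≤ quasiDeriv α r y t₁
  · obtain ⟨t₁, h1, h2⟩ := h
    filter_upwards [eventually_gt_atTop t₁] with t ht
    have h3 := h2.trans_lt (hmono h1 (h1.trans ht.le) ht)
    exact pos_of_Phi_pos (α := α)
      (pos_of_mul_pos_right h3 (E.r_pos t (by linarith)).le)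
  · push Not at h
    exfalso
    have hanti : AntitoneOn y (Ici T) := by
      have hdiff : ∀ t, T ≤ t → DifferentiableAt ℝ y t := fun t ht =>
        ((hC.differentiableOn one_ne_zero) t (hT.trans_le ht)).differentiableAt
          (Ioi_mem_nhds (hT.trans_le ht))
      refine antitoneOn_of_deriv_nonpos (convex_Ici T)
        (fun t ht => (hdiff t ht).continuousAt.continuousWithinAt)
        (fun t ht => (hdiff t (interior_subset ht)).differentiableWithinAt) fun t ht => ?_
      have ht' : T ≤ t := interior_subset ht
      have h1 := h t ht'
      refine (neg_of_Phi_neg (α := α) ?_).le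
      by_contra! h2
      exact absurd h1 (not_lt.2 (mul_nonneg (E.r_pos t (by linarith)).le h2))
    obtain ⟨t, h1, h2⟩ := ((hinf.eventually_gt_atTop (y T)).and (eventually_ge_atTop T)).exists
    exact absurd h1 (not_lt.2 (hanti self_mem_Ici h2 h2))

theorem exists_isGrowingFrom (E : IsRVDelayEquation α β δ a r p τ) (hy : y ∈ IS α a r p τ) :
    ∃ T, IsGrowingFrom α β a r p τ y (quasiDeriv α r y) T := by
  obtain ⟨⟨T₀, ha, hpos, hC, -, hd⟩, hinc⟩ := hy
  obtain ⟨T₁, hT₁, -, hmono⟩ := E.exists_strictMonoOn_quasiDeriv ha hpos hd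
  obtain ⟨T₂, hT₂⟩ := eventually_atTop.1 hinc
  obtain ⟨T₃, hT₃⟩ := eventually_atTop.1
    (E.tendsto_delay.eventually_ge_atTop (max (max T₁ T₂) 1))
  have hder : ∀ t, T₁ ≤ t → T₂ ≤ t → 0 < quasiDeriv α r y t ∧
      HasDerivAt y (quasiDeriv α r y t ^ (β - 1) * r t ^ (1 - β)) t := by
    intro t h1 h2
    have hr := E.r_pos t (by linarith)
    have hy' := hT₂ t h2
    have e : quasiDeriv α r y t = r t * deriv y t ^ (α - 1) := by
      rw [quasiDeriv, Phi_of_pos hy']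
    refine ⟨e ▸ mul_pos hr (Real.rpow_pos_of_pos hy' _), ?_⟩
    have e2 : quasiDeriv α r y t ^ (β - 1) * r t ^ (1 - β) = deriv y t := by
      rw [e, Real.mul_rpow hr.le (Real.rpow_nonneg hy'.le _), ← Real.rpow_mul hy'.le, E.conj,
        Real.rpow_one, mul_right_comm, ← Real.rpow_add hr]
      simp
    rw [e2]
    exact (((hC.differentiableOn one_ne_zero) t (hT₁.trans_le h1)).differentiableAt
          (Ioi_mem_nhds (hT₁.trans_le h1))).hasDerivAt
  have k1 : ∀ t, T₃ ≤ t → T₁ ≤ τ t := fun t ht =>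
    ((le_max_left _ _).trans (le_max_left _ _)).trans (hT₃ t ht)
  have k2 : ∀ t, T₃ ≤ t → T₂ ≤ τ t := fun t ht =>
    ((le_max_right _ _).trans (le_max_left _ _)).trans (hT₃ t ht)
  have k3 : ∀ t, T₃ ≤ t → 0 < τ t := fun t ht =>
    one_pos.trans_le ((le_max_right _ _).trans (hT₃ t ht))
  set T := max (max T₁ T₂) (max T₃ 1) with hTdef
  have l1 : ∀ t, T ≤ t → T₁ ≤ t := fun t ht => by
    exact ((le_max_left _ _).trans (le_max_left _ _)).trans ht
  have l2 : ∀ t, T ≤ t → T₂ ≤ t := fun t ht => by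
    exact ((le_max_right _ _).trans (le_max_left _ _)).trans ht
  have l3 : ∀ t, T ≤ t → T₃ ≤ t := fun t ht => by
    exact ((le_max_left _ _).trans (le_max_right _ _)).trans ht
  have haT : a < T := by linarith [l1 T le_rfl]
  refine ⟨T, haT, one_pos.trans_le ((le_max_right _ _).trans (le_max_right _ _)),
    fun t ht => by linarith [k1 t (l3 t ht)], fun t ht => k3 t (l3 t ht),
    fun t ht => hpos t (by linarith [l1 t ht]),
    fun t ht => hpos _ (by linarith [k1 t (l3 t ht)]),
    fun t ht => (hder t (l1 t ht) (l2 t ht)).1,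
    fun t ht => (hder _ (k1 t (l3 t ht)) (k2 t (l3 t ht))).1,
    hmono.monotoneOn.mono (Ici_subset_Ici.2 (l1 T le_rfl)),
    fun t ht => hmono.monotoneOn (k1 t (l3 t ht)) (l1 t ht) (E.delay_le t (haT.le.trans ht)),
    fun t ht => (hd _ (by linarith [k1 t (l3 t ht)])).continuousAt,
    fun t ht => (hder t (l1 t ht) (l2 t ht)).2, fun t ht => ?_, fun t ht => ?_⟩
  · have := (hder _ (k1 t (l3 t ht)) (k2 t (l3 t ht))).2.comp t
      (E.hasDerivAt_delay (haT.trans_le ht))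
    rw [mul_assoc] at this
    exact this
  · have := hd t (by linarith [l1 t ht])
    rwa [Phi_of_pos (hpos _ (by linarith [k1 t (l3 t ht)]))] at this

end IsRVDelayEquation

/-! ### Asymptotics of increasing solutions -/

namespace IsGrowingFrom

variable {q : ℝ → ℝ} {T : ℝ}

theorem continuousOn_q (G : IsGrowingFrom α β a r p τ y q T) : ContinuousOn q (Ici T) :=
  fun t ht => (G.hasDerivAt_q t ht).continuousAt.continuousWithinAt

theorem continuousOn_deriv_q (G : IsGrowingFrom α β a r p τ y q T)
    (E : IsRVDelayEquation α β δ a r p τ) :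
    ContinuousOn (fun t => p t * y (τ t) ^ (α - 1)) (Ici T) :=
  (E.continuousOn_p.mono (Ici_subset_Ici.2 G.a_lt.le)).mul
    (ContinuousOn.rpow_const (fun t ht =>
      (G.hasDerivAt_delay t ht).continuousAt.continuousWithinAt) fun _ _ =>
        Or.inr E.sub_one_pos.le)

theorem deriv_q_pos (G : IsGrowingFrom α β a r p τ y q T) (E : IsRVDelayEquation α β δ a r p τ)
    {t : ℝ} (ht : T ≤ t) : 0 < p t * y (τ t) ^ (α - 1) :=
  mul_pos (E.p_pos t (G.a_lt.le.trans ht)) (Real.rpow_pos_of_pos (G.pos_delay t ht) _)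

theorem rpow_q (G : IsGrowingFrom α β a r p τ y q T) (E : IsRVDelayEquation α β δ a r p τ)
    {t : ℝ} (ht : T ≤ t) : (q t ^ (β - 1)) ^ (α - 1) = q t := by
  rw [← Real.rpow_mul (G.q_pos t ht).le, mul_comm, E.conj, Real.rpow_one]

theorem delayed_weight_pos (G : IsGrowingFrom α β a r p τ y q T)
    (E : IsRVDelayEquation α β δ a r p τ) {t : ℝ} (ht : T ≤ t) :
    0 < r (τ t) ^ (1 - β) * tauDeriv a τ t :=
  mul_pos (Real.rpow_pos_of_pos (E.r_pos _ (G.a_lt_delay t ht).le) _)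
    (E.tauDeriv_pos t (G.a_lt.le.trans ht))

theorem continuousOn_delayed_weight (G : IsGrowingFrom α β a r p τ y q T)
    (E : IsRVDelayEquation α β δ a r p τ) :
    ContinuousOn (fun t => r (τ t) ^ (1 - β) * tauDeriv a τ t) (Ici T) :=
  E.continuousOn_delayed_weight G.a_lt.le fun t ht => (G.a_lt_delay t ht).le

/-- As `q` increases, integrating `(y ∘ τ)' = (q ∘ τ)^(β-1) R`, `R = (r ∘ τ)^(1-β) τ'`, gives
`y ∘ τ ≤ const + q^(β-1) ∫ R`, and Karamata's theorem evaluates `∫ R`. -/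
theorem exists_delay_le (G : IsGrowingFrom α β a r p τ y q T)
    (E : IsRVDelayEquation α β δ a r p τ) :
    ∃ C, 0 < C ∧ ∀ᶠ t in atTop,
      y (τ t) ≤ C * (q t ^ (β - 1) * (t * (r (τ t) ^ (1 - β) * tauDeriv a τ t))) := by
  set R : ℝ → ℝ := fun t => r (τ t) ^ (1 - β) * tauDeriv a τ t with hR
  have hϱ := E.rvIndex_pos
  have hidx : δ * (1 - β) - β = rvIndex α δ - 1 := by rw [E.rvIndex_eq]; ring
  have hRV : IsRV R (rvIndex α δ - 1) := hidx ▸ E.isRV_delay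
  have hRc : ContinuousOn R (Ici T) := G.continuousOn_delayed_weight E
  have hRi : ∀ t, T ≤ t → IntervalIntegrable R volume T t := fun t ht =>
    ContinuousOn.intervalIntegrable (hRc.mono (by
      rw [uIcc_of_le ht]; exact Icc_subset_Ici_self))
  have hI : Tendsto (fun t => (∫ s in T..t, R s) / (t * R t)) atTop (𝓝 (1 / rvIndex α δ)) := by
    have := hRV.tendsto_primitive_div (F := fun t => ∫ s in T..t, R s) (A := T + 1)
      (by linarith) (hRc.mono (Ici_subset_Ici.2 (by linarith))) fun t ht => by
        have hTt : T < t := by linarith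
        have hn : Ici T ∈ 𝓝 t := Ici_mem_nhds hTt
        exact intervalIntegral.integral_hasDerivAt_right (hRi t hTt.le)
          (hRc.stronglyMeasurableAtFilter_nhdsWithin measurableSet_Ici t |>.filter_mono
            (le_inf le_rfl (le_principal_iff.2 hn)))
          (hRc.continuousAt hn)
    simpa using this
  have htR : Tendsto (fun t => t * R t) atTop atTop :=
    (isRV_id.mul hRV).tendsto_atTop (by linarith)
  set D := 1 / rvIndex α δ + 1
  have hD : 0 < D := by positivity
  have hw : ∀ t, T ≤ t → y (τ t) - y (τ T) ≤ q t ^ (β - 1) * ∫ s in T..t, R s := by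
    intro t ht
    have hsub : Icc T t ⊆ Ici T := Icc_subset_Ici_self
    have hc : ContinuousOn (fun s => q (τ s) ^ (β - 1) * R s) (Ici T) :=
      ContinuousOn.mul (ContinuousOn.rpow_const (fun s hs =>
        ((G.continuousAt_q_delay s hs).comp (E.hasDerivAt_delay
          (G.a_lt.trans_le hs)).continuousAt).continuousWithinAt) fun _ _ =>
            Or.inr E.conj_sub_one_pos.le) hRc
    have hi : IntervalIntegrable (fun s => q (τ s) ^ (β - 1) * R s) volume T t :=
      ContinuousOn.intervalIntegrable (hc.mono (by rwa [uIcc_of_le ht]))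
    rw [← intervalIntegral.integral_const_mul,
      ← intervalIntegral.integral_eq_sub_of_hasDerivAt (f := fun t => y (τ t)) (fun s hs => by
        rw [uIcc_of_le ht] at hs
        exact G.hasDerivAt_delay s hs.1) hi]
    refine intervalIntegral.integral_mono_on ht hi ((hRi t ht).const_mul _) fun s hs => ?_
    refine mul_le_mul_of_nonneg_right ?_ (G.delayed_weight_pos E hs.1).le
    exact Real.rpow_le_rpow (G.q_pos_delay s hs.1).le
      ((G.q_delay_le s hs.1).trans (G.q_mono hs.1 ht hs.2)) E.conj_sub_one_pos.le
  have hqT : 0 < q T ^ (β - 1) := Real.rpow_pos_of_pos (G.q_pos T le_rfl) _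
  refine ⟨1 + D, by positivity, ?_⟩
  filter_upwards [eventually_ge_atTop T, hI.eventually_le_const (lt_add_one _),
    htR.eventually_ge_atTop (y (τ T) / q T ^ (β - 1))] with t ht h1 h2
  have hRt : 0 < t * R t := mul_pos (G.T_pos.trans_le ht) (G.delayed_weight_pos E ht)
  rw [div_le_iff₀ hRt] at h1
  rw [div_le_iff₀ hqT] at h2
  have hq : q T ^ (β - 1) ≤ q t ^ (β - 1) := Real.rpow_le_rpow (G.q_pos T le_rfl).le
    (G.q_mono self_mem_Ici ht ht) E.conj_sub_one_pos.le
  have h3 := hw t ht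
  have h4 : q t ^ (β - 1) * (∫ s in T..t, R s) ≤ q t ^ (β - 1) * (D * (t * R t)) :=
    mul_le_mul_of_nonneg_left h1 (hqT.le.trans hq)
  have h5 : t * R t * q T ^ (β - 1) ≤ t * R t * q t ^ (β - 1) :=
    mul_le_mul_of_nonneg_left hq hRt.le
  calc y (τ t) ≤ q t ^ (β - 1) * (D * (t * R t)) + t * R t * q t ^ (β - 1) := by linarith
    _ = _ := by ring

/-- The quasiderivative is slowly varying: `t q' / q` is at most a multiple of `t H_τ(t)`. -/
theorem tendsto_elasticity_q (G : IsGrowingFrom α β a r p τ y q T)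
    (E : IsRVDelayEquation α β δ a r p τ) :
    Tendsto (fun t => t * (p t * y (τ t) ^ (α - 1)) / q t) atTop (𝓝 0) := by
  obtain ⟨C, hC, hle⟩ := G.exists_delay_le E
  have h := E.tendsto_mul_Htau.const_mul (C ^ (α - 1))
  rw [mul_zero] at h
  refine squeeze_zero' ?_ ?_ h
  · filter_upwards [eventually_ge_atTop T] with t ht
    have := G.deriv_q_pos E ht
    have := G.q_pos t ht
    have := G.T_pos.trans_le ht
    positivity
  · filter_upwards [eventually_ge_atTop T, hle] with t ht h1
    have hq := G.q_pos t ht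
    have ht0 := G.T_pos.trans_le ht
    have hp := E.p_pos t (G.a_lt.le.trans ht)
    have hR := G.delayed_weight_pos E ht
    rw [div_le_iff₀ hq, E.Htau_eq (G.a_lt.le.trans ht) ht0.le (G.a_lt_delay t ht).le]
    have h2 := Real.rpow_le_rpow (G.pos_delay t ht).le h1 E.sub_one_pos.le
    rw [Real.mul_rpow hC.le (by positivity), Real.mul_rpow (by positivity) (by positivity),
      G.rpow_q E ht] at h2
    calc t * (p t * y (τ t) ^ (α - 1)) ≤ t * (p t * (C ^ (α - 1) * (q t *
          (t * (r (τ t) ^ (1 - β) * tauDeriv a τ t)) ^ (α - 1)))) := by gcongr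
      _ = _ := by ring

theorem isRV_q (G : IsGrowingFrom α β a r p τ y q T) (E : IsRVDelayEquation α β δ a r p τ) :
    IsRV q 0 :=
  (isNRV_of_tendsto_elasticity G.hasDerivAt_q G.q_pos (G.continuousOn_deriv_q E)
    (G.tendsto_elasticity_q E)).isRV

theorem tendsto_div_deriv (G : IsGrowingFrom α β a r p τ y q T)
    (E : IsRVDelayEquation α β δ a r p τ) :
    Tendsto (fun t => y t / (t * (q t ^ (β - 1) * r t ^ (1 - β)))) atTop
      (𝓝 (1 / rvIndex α δ)) := by
  have hRV := ((G.isRV_q E).rpow (β - 1)).mul (E.isRV_r.rpow (1 - β))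
  have hidx : 0 * (β - 1) + (δ + α) * (1 - β) = rvIndex α δ - 1 := by
    rw [E.rvIndex_eq]; linarith [E.conj]
  rw [hidx] at hRV
  have := hRV.tendsto_primitive_div (by linarith [E.rvIndex_pos])
    ((G.continuousOn_q.rpow_const fun _ _ => Or.inr E.conj_sub_one_pos.le).mul
      ((E.continuousOn_r.mono (Ici_subset_Ici.2 G.a_lt.le)).rpow_const fun t ht =>
        Or.inl (E.r_pos t (G.a_lt.le.trans ht)).ne')) G.hasDerivAt
  simpa using this

/-- `t y' / y → ϱ`, by Karamata's theorem for `y' = q^(β-1) r^(1-β)`. -/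
theorem isNRV (G : IsGrowingFrom α β a r p τ y q T) (E : IsRVDelayEquation α β δ a r p τ) :
    IsNRV y (rvIndex α δ) := by
  refine isNRV_of_tendsto_elasticity G.hasDerivAt G.pos
    ((G.continuousOn_q.rpow_const fun _ _ => Or.inr E.conj_sub_one_pos.le).mul
      ((E.continuousOn_r.mono (Ici_subset_Ici.2 G.a_lt.le)).rpow_const fun t ht =>
        Or.inl (E.r_pos t (G.a_lt.le.trans ht)).ne')) ?_
  simpa using (G.tendsto_div_deriv E).inv₀ (by simpa using E.rvIndex_pos.ne')

theorem tendsto_q_delay_div (G : IsGrowingFrom α β a r p τ y q T)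
    (E : IsRVDelayEquation α β δ a r p τ) :
    Tendsto (fun t => q (τ t) / q t) atTop (𝓝 1) := by
  obtain ⟨K, hK⟩ := E.delay_bound
  simpa using (G.isRV_q E).tendsto_comp_div ((eventually_ge_atTop a).mono E.delay_le) hK
    E.tendsto_delay

theorem continuousOn_q_delay (G : IsGrowingFrom α β a r p τ y q T)
    (E : IsRVDelayEquation α β δ a r p τ) : ContinuousOn (fun t => q (τ t)) (Ici T) :=
  fun t ht => ((G.continuousAt_q_delay t ht).comp
    (E.hasDerivAt_delay (G.a_lt.trans_le ht)).continuousAt).continuousWithinAt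

theorem continuousOn_deriv_delay (G : IsGrowingFrom α β a r p τ y q T)
    (E : IsRVDelayEquation α β δ a r p τ) : ContinuousOn (fun t =>
      q (τ t) ^ (β - 1) * (r (τ t) ^ (1 - β) * tauDeriv a τ t)) (Ici T) :=
  ((G.continuousOn_q_delay E).rpow_const fun _ _ => Or.inr E.conj_sub_one_pos.le).mul
    (G.continuousOn_delayed_weight E)

/-- Karamata's theorem for `(y ∘ τ)'`, which is regularly varying because `q ∘ τ ∼ q`. -/
theorem tendsto_delay_div_deriv (G : IsGrowingFrom α β a r p τ y q T)
    (E : IsRVDelayEquation α β δ a r p τ) :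
    Tendsto (fun t => y (τ t) /
      (t * (q (τ t) ^ (β - 1) * (r (τ t) ^ (1 - β) * tauDeriv a τ t)))) atTop
      (𝓝 (1 / rvIndex α δ)) := by
  have hq : IsRV (fun t => q (τ t)) 0 := (G.isRV_q E).of_tendsto_div_one
    (G.continuousOn_q_delay E) G.q_pos_delay (G.tendsto_q_delay_div E)
  have hRV := (hq.rpow (β - 1)).mul E.isRV_delay
  have hidx : 0 * (β - 1) + (δ * (1 - β) - β) = rvIndex α δ - 1 := by
    rw [E.rvIndex_eq]; ring
  rw [hidx] at hRV
  simpa using hRV.tendsto_primitive_div (by linarith [E.rvIndex_pos])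
    (G.continuousOn_deriv_delay E) G.hasDerivAt_delay

theorem isRV_deriv_q (G : IsGrowingFrom α β a r p τ y q T)
    (E : IsRVDelayEquation α β δ a r p τ) : IsRV (fun t => p t * y (τ t) ^ (α - 1)) (-1) := by
  have h : IsRV (fun t => y (τ t)) (rvIndex α δ) := by
    refine (isNRV_of_tendsto_elasticity G.hasDerivAt_delay G.pos_delay
      (G.continuousOn_deriv_delay E) ?_).isRV
    simpa using (G.tendsto_delay_div_deriv E).inv₀ (by simpa using E.rvIndex_pos.ne')
  have := E.isRV_p.mul (h.rpow (α - 1))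
  rw [E.rvIndex_mul] at this
  convert this using 1
  ring

/-- The exact rate of the slow variation of the quasiderivative: `q' / q ∼ H_τ / ϱ^(α-1)`. -/
theorem tendsto_deriv_q_div (G : IsGrowingFrom α β a r p τ y q T)
    (E : IsRVDelayEquation α β δ a r p τ) :
    Tendsto (fun t => p t * y (τ t) ^ (α - 1) / q t / Htau α a r p τ t) atTop
      (𝓝 (1 / rvIndex α δ ^ (α - 1))) := by
  have h1 := (G.tendsto_delay_div_deriv E).rpow_const (p := α - 1) (Or.inr E.sub_one_pos.le)
  have h2 := h1.mul (G.tendsto_q_delay_div E)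
  rw [mul_one, Real.div_rpow zero_le_one E.rvIndex_pos.le, Real.one_rpow] at h2
  refine h2.congr' ?_
  filter_upwards [eventually_ge_atTop T] with t ht
  have hq := G.q_pos t ht
  have hqτ := G.q_pos_delay t ht
  have ht0 := G.T_pos.trans_le ht
  have hp := E.p_pos t (G.a_lt.le.trans ht)
  have hR := G.delayed_weight_pos E ht
  have hy := G.pos_delay t ht
  rw [E.Htau_eq (G.a_lt.le.trans ht) ht0.le (G.a_lt_delay t ht).le]
  set R := r (τ t) ^ (1 - β) * tauDeriv a τ t
  have e : t * (q (τ t) ^ (β - 1) * R) = q (τ t) ^ (β - 1) * (t * R) := by ring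
  have hX : 0 < (t * R) ^ (α - 1) := Real.rpow_pos_of_pos (by positivity) _
  rw [e, Real.div_rpow hy.le (by positivity), Real.mul_rpow (by positivity) (by positivity),
    ← Real.rpow_mul hqτ.le, mul_comm (β - 1), E.conj, Real.rpow_one]
  field_simp

/-- De Haan's class: `q(λt) - q(t) = ∫_t^{λt} q'`, and `q'` is regularly varying of index `-1`,
uniformly on compact sets of ratios. -/
theorem tendsto_sub_div (G : IsGrowingFrom α β a r p τ y q T)
    (E : IsRVDelayEquation α β δ a r p τ) {l : ℝ} (hl : 0 < l) :
    Tendsto (fun t => (q (l * t) - q t) / (t * (p t * y (τ t) ^ (α - 1)))) atTop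
      (𝓝 (Real.log l)) := by
  have h := (G.isRV_deriv_q E).tendsto_increment_div (G.continuousOn_deriv_q E) G.hasDerivAt_q hl
  simp only [Real.rpow_neg_one] at h
  rwa [integral_inv_of_pos one_pos hl, div_one] at h

end IsGrowingFrom

/-- L'Hôpital's rule at `∞`, for a denominator that increases to `∞`. -/
theorem tendsto_div_of_tendsto_deriv_div {F J f g : ℝ → ℝ} {A c : ℝ}
    (hF : ∀ t, A ≤ t → HasDerivAt F (f t) t) (hJ : ∀ t, A ≤ t → HasDerivAt J (g t) t)
    (hg : ∀ t, A ≤ t → 0 < g t) (hJ_top : Tendsto J atTop atTop)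
    (h : Tendsto (fun t => f t / g t) atTop (𝓝 c)) :
    Tendsto (fun t => F t / J t) atTop (𝓝 c) := by
  -- The difference `D = F - c J` satisfies `|D'| ≤ η J'`, whence `|D| ≤ const + η J`.
  have key : Tendsto (fun t => (F t - c * J t) / J t) atTop (𝓝 0) := by
    rw [Metric.tendsto_nhds]
    intro ε hε
    obtain ⟨B, hB⟩ := eventually_atTop.1 ((Metric.tendsto_nhds.1 h) (ε / 2) (half_pos hε))
    set S := max A B with hS
    have hder : ∀ t, S ≤ t → |f t - c * g t| ≤ ε / 2 * g t := fun t ht => by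
      have h1 := hB t ((le_max_right _ _).trans ht)
      have h2 := hg t ((le_max_left _ _).trans ht)
      rw [Real.dist_eq] at h1
      have e : f t - c * g t = (f t / g t - c) * g t := by field_simp
      rw [e, abs_mul, abs_of_pos h2]
      exact mul_le_mul_of_nonneg_right h1.le h2.le
    have hA : ∀ t, S ≤ t → A ≤ t := fun t ht => (le_max_left _ _).trans ht
    have mono : ∀ σ : ℝ, |σ| = 1 →
        MonotoneOn (fun t => ε / 2 * J t + σ * (F t - c * J t)) (Ici S) := by
      intro σ hσ
      have hd : ∀ t, S ≤ t → HasDerivAt (fun t => ε / 2 * J t + σ * (F t - c * J t))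
          (ε / 2 * g t + σ * (f t - c * g t)) t := fun t ht =>
        ((hJ t (hA t ht)).const_mul _).add
          (((hF t (hA t ht)).sub ((hJ t (hA t ht)).const_mul c)).const_mul σ)
      refine monotoneOn_of_deriv_nonneg (convex_Ici S)
        (fun t ht => (hd t ht).continuousAt.continuousWithinAt)
        (fun t ht => (hd t (interior_subset ht)).differentiableAt.differentiableWithinAt)
        fun t ht => ?_
      rw [(hd t (interior_subset ht)).deriv]
      have h1 := hder t (interior_subset ht)
      have h2 := neg_abs_le (σ * (f t - c * g t))
      rw [abs_mul, hσ, one_mul] at h2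
      linarith
    filter_upwards [eventually_ge_atTop S, hJ_top.eventually_gt_atTop 0,
      hJ_top.eventually_gt_atTop (2 / ε * (|F S - c * J S| - ε / 2 * J S))] with t ht h1 h2
    have m1 := mono 1 (by simp) self_mem_Ici ht ht
    have m2 := mono (-1) (by simp) self_mem_Ici ht ht
    simp only at m1 m2
    rw [div_mul_eq_mul_div, div_lt_iff₀ hε] at h2
    rw [dist_zero_right, norm_div, Real.norm_of_nonneg h1.le, div_lt_iff₀ h1, Real.norm_eq_abs,
      abs_lt]
    constructor <;> linarith [le_abs_self (F S - c * J S), neg_abs_le (F S - c * J S)]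
  have := key.add_const c
  rw [zero_add] at this
  refine this.congr' ?_
  filter_upwards [hJ_top.eventually_gt_atTop 0] with t ht
  field_simp
  ring

namespace IsGrowingFrom

variable {q : ℝ → ℝ} {T t₀ : ℝ}

/-! ### Representation of the quasiderivative -/

theorem mono (G : IsGrowingFrom α β a r p τ y q T) {S : ℝ} (hS : T ≤ S) :
    IsGrowingFrom α β a r p τ y q S where
  a_lt := G.a_lt.trans_le hS
  T_pos := G.T_pos.trans_le hS
  a_lt_delay t ht := G.a_lt_delay t (hS.trans ht)
  delay_pos t ht := G.delay_pos t (hS.trans ht)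
  pos t ht := G.pos t (hS.trans ht)
  pos_delay t ht := G.pos_delay t (hS.trans ht)
  q_pos t ht := G.q_pos t (hS.trans ht)
  q_pos_delay t ht := G.q_pos_delay t (hS.trans ht)
  q_mono := G.q_mono.mono (Ici_subset_Ici.2 hS)
  q_delay_le t ht := G.q_delay_le t (hS.trans ht)
  continuousAt_q_delay t ht := G.continuousAt_q_delay t (hS.trans ht)
  hasDerivAt t ht := G.hasDerivAt t (hS.trans ht)
  hasDerivAt_delay t ht := G.hasDerivAt_delay t (hS.trans ht)
  hasDerivAt_q t ht := G.hasDerivAt_q t (hS.trans ht)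

theorem hasDerivAt_log_q (G : IsGrowingFrom α β a r p τ y q T) {t : ℝ} (ht : T ≤ t) :
    HasDerivAt (fun t => Real.log (q t)) (p t * y (τ t) ^ (α - 1) / q t) t :=
  (G.hasDerivAt_q t ht).log (G.q_pos t ht).ne'

theorem continuousOn_deriv_log_q (G : IsGrowingFrom α β a r p τ y q T)
    (E : IsRVDelayEquation α β δ a r p τ) :
    ContinuousOn (fun t => p t * y (τ t) ^ (α - 1) / q t) (Ici T) :=
  (G.continuousOn_deriv_q E).div G.continuousOn_q fun t ht => (G.q_pos t ht).ne'

theorem Htau_pos (G : IsGrowingFrom α β a r p τ y q T) (E : IsRVDelayEquation α β δ a r p τ)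
    {t : ℝ} (ht : T ≤ t) : 0 < Htau α a r p τ t :=
  E.Htau_pos (G.a_lt.le.trans ht) (G.T_pos.trans_le ht) (G.a_lt_delay t ht).le

/-- The relative error in `q' / q ∼ H_τ / ϱ^(α-1)` extends to a continuous function on `ℝ`,
constant to the left of `T`. -/
theorem exists_relative_error (G : IsGrowingFrom α β a r p τ y q T)
    (E : IsRVDelayEquation α β δ a r p τ) :
    ∃ ε : ℝ → ℝ, Continuous ε ∧ Tendsto ε atTop (𝓝 0) ∧ ∀ t, T ≤ t →
      (1 + ε t) * Htau α a r p τ t =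
        rvIndex α δ ^ (α - 1) * (p t * y (τ t) ^ (α - 1) / q t) := by
  have hϱ : 0 < rvIndex α δ ^ (α - 1) := Real.rpow_pos_of_pos E.rvIndex_pos _
  have hH : ContinuousOn (Htau α a r p τ) (Ici T) :=
    E.continuousOn_Htau G.a_lt.le fun t ht => (G.a_lt_delay t ht).le
  have h0 : Tendsto (fun t => rvIndex α δ ^ (α - 1) *
      (p t * y (τ t) ^ (α - 1) / q t / Htau α a r p τ t) - 1) atTop (𝓝 0) := by
    have := ((G.tendsto_deriv_q_div E).const_mul (rvIndex α δ ^ (α - 1))).sub_const 1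
    rwa [mul_one_div, div_self hϱ.ne', sub_self] at this
  have hc : ContinuousOn (fun t => rvIndex α δ ^ (α - 1) *
      (p t * y (τ t) ^ (α - 1) / q t / Htau α a r p τ t) - 1) (Ici T) :=
    (continuousOn_const.mul ((G.continuousOn_deriv_log_q E).div hH fun t ht =>
      (G.Htau_pos E ht).ne')).sub continuousOn_const
  refine ⟨_, continuous_comp_max hc, tendsto_comp_max h0, fun t ht => ?_⟩
  have := G.Htau_pos E ht
  have := G.q_pos t ht
  simp only [max_eq_left ht]
  field_simp
  ring

theorem integral_deriv_log_q (G : IsGrowingFrom α β a r p τ y q T)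
    (E : IsRVDelayEquation α β δ a r p τ) {t : ℝ} (ht : T ≤ t) :
    ∫ s in T..t, p s * y (τ s) ^ (α - 1) / q s = Real.log (q t) - Real.log (q T) := by
  refine intervalIntegral.integral_eq_sub_of_hasDerivAt
    (f := fun s => Real.log (q s)) (fun s hs => ?_) (ContinuousOn.intervalIntegrable
      ((G.continuousOn_deriv_log_q E).mono ?_))
  · rw [uIcc_of_le ht] at hs
    exact G.hasDerivAt_log_q hs.1
  · rw [uIcc_of_le ht]
    exact Icc_subset_Ici_self

/-- A perturbation of the relative error supported in `[t₀, T]` absorbs the integration constant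
in `log q = const + ∫ q' / q`. -/
theorem exists_integral_eq_log_q (G : IsGrowingFrom α β a r p τ y q T)
    (E : IsRVDelayEquation α β δ a r p τ) (h0 : 0 ≤ t₀) (ha : a ≤ t₀)
    (hτ : ∀ t, t₀ ≤ t → a ≤ τ t) :
    ∃ ε : ℝ → ℝ, Continuous ε ∧ Tendsto ε atTop (𝓝 0) ∧ ∀ᶠ t in atTop,
      ∫ s in t₀..t, (1 + ε s) * Htau α a r p τ s =
        rvIndex α δ ^ (α - 1) * Real.log (q t) := by
  obtain ⟨S, hTS, htS⟩ : ∃ S, T ≤ S ∧ t₀ < S :=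
    ⟨max T (t₀ + 1), le_max_left _ _, (lt_add_one _).trans_le (le_max_right _ _)⟩
  have G' := G.mono hTS
  obtain ⟨ε₁, hc, h1, hε⟩ := G'.exists_relative_error E
  have hH : ContinuousOn (Htau α a r p τ) (Ici t₀) := E.continuousOn_Htau ha hτ
  have hint : ∀ f : ℝ → ℝ, Continuous f → ∀ u, t₀ ≤ u → ∀ v, t₀ ≤ v →
      IntervalIntegrable (fun s => f s * Htau α a r p τ s) volume u v :=
    fun f hf u hu v hv => ContinuousOn.intervalIntegrable
      ((hf.continuousOn.mul hH).mono fun x hx => (le_min hu hv).trans hx.1)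
  have hb : Continuous fun s : ℝ => max 0 (S - s) :=
    continuous_const.max (continuous_const.sub continuous_id)
  have hP : 0 < ∫ s in t₀..S, max 0 (S - s) * Htau α a r p τ s := by
    refine intervalIntegral.intervalIntegral_pos_of_pos_on (hint _ hb _ le_rfl _ htS.le)
      (fun s hs => mul_pos (lt_max_of_lt_right (sub_pos.2 hs.2))
        (E.Htau_pos (ha.trans hs.1.le) (h0.trans_lt hs.1) (hτ s hs.1.le))) htS
  set P := ∫ s in t₀..S, max 0 (S - s) * Htau α a r p τ s
  set c := (rvIndex α δ ^ (α - 1) * Real.log (q S) -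
    ∫ s in t₀..S, (1 + ε₁ s) * Htau α a r p τ s) / P with hcdef
  have hεc : Continuous fun s => 1 + (ε₁ s + c * max 0 (S - s)) :=
    continuous_const.add (hc.add (continuous_const.mul hb))
  refine ⟨fun s => ε₁ s + c * max 0 (S - s), hc.add (continuous_const.mul hb), ?_, ?_⟩
  · refine h1.congr' ?_
    filter_upwards [eventually_ge_atTop S] with s hs
    rw [max_eq_left (sub_nonpos.2 hs), mul_zero, add_zero]
  · filter_upwards [eventually_ge_atTop S] with t ht
    rw [← intervalIntegral.integral_add_adjacent_intervals
      (hint _ hεc _ le_rfl _ htS.le) (hint _ hεc _ htS.le _ (htS.le.trans ht))]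
    have e1 : ∫ s in t₀..S, (1 + (ε₁ s + c * max 0 (S - s))) * Htau α a r p τ s =
        (∫ s in t₀..S, (1 + ε₁ s) * Htau α a r p τ s) + c * P := by
      have hc1 : Continuous fun s => 1 + ε₁ s := continuous_const.add hc
      rw [← intervalIntegral.integral_const_mul, ← intervalIntegral.integral_add
        (hint _ hc1 _ le_rfl _ htS.le) ((hint _ hb _ le_rfl _ htS.le).const_mul c)]
      exact intervalIntegral.integral_congr fun s _ => by ring
    have e2 : ∫ s in S..t, (1 + (ε₁ s + c * max 0 (S - s))) * Htau α a r p τ s =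
        rvIndex α δ ^ (α - 1) * (Real.log (q t) - Real.log (q S)) := by
      rw [← G'.integral_deriv_log_q E ht, ← intervalIntegral.integral_const_mul]
      refine intervalIntegral.integral_congr fun s hs => ?_
      rw [uIcc_of_le ht] at hs
      rw [← hε s hs.1, max_eq_left (sub_nonpos.2 hs.1), mul_zero, add_zero]
    rw [e1, e2, hcdef, div_mul_cancel₀ _ hP.ne']
    ring

/-- When `∫ H_τ` diverges, `log q ∼ ∫ H_τ / ϱ^(α-1)`. -/
theorem tendsto_log_q_div (G : IsGrowingFrom α β a r p τ y q T)
    (E : IsRVDelayEquation α β δ a r p τ) (ha : a ≤ t₀) (hτ : ∀ t, t₀ ≤ t → a ≤ τ t)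
    (hdiv : Tendsto (fun t => ∫ s in t₀..t, Htau α a r p τ s) atTop atTop) :
    Tendsto (fun t => Real.log (q t) / ∫ s in t₀..t, Htau α a r p τ s) atTop
      (𝓝 (1 / rvIndex α δ ^ (α - 1))) := by
  obtain ⟨S, hTS, htS⟩ : ∃ S, T ≤ S ∧ t₀ < S :=
    ⟨max T (t₀ + 1), le_max_left _ _, (lt_add_one _).trans_le (le_max_right _ _)⟩
  have hH : ContinuousOn (Htau α a r p τ) (Ici t₀) := E.continuousOn_Htau ha hτ
  refine tendsto_div_of_tendsto_deriv_div (A := S)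
    (fun t ht => G.hasDerivAt_log_q (hTS.trans ht)) (fun t ht => ?_)
    (fun t ht => G.Htau_pos E (hTS.trans ht)) hdiv (G.tendsto_deriv_q_div E)
  have htt : t₀ < t := htS.trans_le ht
  have hn : Ici t₀ ∈ 𝓝 t := Ici_mem_nhds htt
  refine intervalIntegral.integral_hasDerivAt_right (ContinuousOn.intervalIntegrable (hH.mono ?_))
    (hH.stronglyMeasurableAtFilter_nhdsWithin measurableSet_Ici t |>.filter_mono
      (le_inf le_rfl (le_principal_iff.2 hn))) (hH.continuousAt hn)
  rw [uIcc_of_le htt.le]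
  exact Icc_subset_Ici_self

theorem tendsto_q_atTop (G : IsGrowingFrom α β a r p τ y q T)
    (E : IsRVDelayEquation α β δ a r p τ) (ha : a ≤ t₀) (hτ : ∀ t, t₀ ≤ t → a ≤ τ t)
    (hdiv : Tendsto (fun t => ∫ s in t₀..t, Htau α a r p τ s) atTop atTop) :
    Tendsto q atTop atTop := by
  have h := (G.tendsto_log_q_div E ha hτ hdiv).pos_mul_atTop
    (one_div_pos.2 (Real.rpow_pos_of_pos E.rvIndex_pos _)) hdiv
  refine (Real.tendsto_exp_atTop.comp h).congr' ?_
  filter_upwards [eventually_ge_atTop T, hdiv.eventually_gt_atTop 0] with t ht h1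
  rw [Function.comp, div_mul_cancel₀ _ h1.ne', Real.exp_log (G.q_pos t ht)]

/-! ### The divergent case -/

/-- Karamata's theorem for `y' = q^(β-1) r^(1-β)`, with the explicit factor `t r^(1-β)` split off. -/
theorem tendsto_div_main_term (G : IsGrowingFrom α β a r p τ y q T)
    (E : IsRVDelayEquation α β δ a r p τ) :
    Tendsto (fun t => y t / (t * r t ^ (1 - β)) / q t ^ (β - 1)) atTop
      (𝓝 (1 / rvIndex α δ)) := by
  refine (G.tendsto_div_deriv E).congr fun t => ?_
  rw [div_div]
  congr 1
  ring

theorem main_term_pos (G : IsGrowingFrom α β a r p τ y q T)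
    (E : IsRVDelayEquation α β δ a r p τ) {t : ℝ} (ht : T ≤ t) : 0 < t * r t ^ (1 - β) :=
  mul_pos (G.T_pos.trans_le ht)
    (Real.rpow_pos_of_pos (E.r_pos t (G.a_lt.le.trans ht)) _)

/-- The representation with `ε(t)` outside of the integral: `ε` is defined by the formula itself, and
`log q ∼ ∫ H_τ / ϱ^(α-1)` shows that it tends to zero. -/
theorem exists_eq_mul_exp_of_divergent (G : IsGrowingFrom α β a r p τ y q T)
    (E : IsRVDelayEquation α β δ a r p τ) (ha : a ≤ t₀) (hτ : ∀ t, t₀ ≤ t → a ≤ τ t)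
    (hdiv : Tendsto (fun t => ∫ s in t₀..t, Htau α a r p τ s) atTop atTop) :
    ∃ ε : ℝ → ℝ, Tendsto ε atTop (𝓝 0) ∧
      ∀ᶠ t in atTop, y t = t * r t ^ (1 - β) *
        Real.exp (∫ s in t₀..t,
          (1 + ε t) * ((β - 1) / Phi α (rvIndex α δ)) * Htau α a r p τ s) := by
  have hϱ : 0 < rvIndex α δ ^ (α - 1) := Real.rpow_pos_of_pos E.rvIndex_pos _
  have hβ := E.conj_sub_one_pos
  set J : ℝ → ℝ := fun t => ∫ s in t₀..t, Htau α a r p τ s with hJ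
  set κ := (β - 1) / rvIndex α δ ^ (α - 1) with hκ
  have hκ0 : 0 < κ := div_pos hβ hϱ
  refine ⟨fun t => Real.log (y t / (t * r t ^ (1 - β))) / (κ * J t) - 1, ?_, ?_⟩
  · have h1 := (G.tendsto_log_q_div E ha hτ hdiv).const_mul ((β - 1) / κ)
    have h2 := (((G.tendsto_div_main_term E).log
      (one_div_pos.2 E.rvIndex_pos).ne').div_atTop (hdiv.const_mul_atTop hκ0))
    have h3 := (h1.add h2).sub_const 1
    have e : (β - 1) / κ * (1 / rvIndex α δ ^ (α - 1)) + 0 - 1 = 0 := by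
      rw [hκ]; field_simp; ring
    rw [e] at h3
    refine h3.congr' ?_
    filter_upwards [eventually_ge_atTop T, hdiv.eventually_gt_atTop 0] with t ht hJt
    have hm := G.main_term_pos E ht
    have hy := G.pos t ht
    have hq := G.q_pos t ht
    have hqβ : 0 < q t ^ (β - 1) := Real.rpow_pos_of_pos hq _
    rw [Real.log_div (div_pos hy hm).ne' hqβ.ne', Real.log_rpow hq]
    have : J t ≠ 0 := hJt.ne'
    change (β - 1) / κ * (Real.log (q t) / J t) + _ / (κ * J t) - 1 = _
    field_simp
    ring
  · filter_upwards [eventually_ge_atTop T, hdiv.eventually_gt_atTop 0] with t ht hJt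
    have hm := G.main_term_pos E ht
    have hJt' : J t ≠ 0 := hJt.ne'
    rw [intervalIntegral.integral_const_mul, Phi_of_pos E.rvIndex_pos, ← hκ]
    change y t = t * r t ^ (1 - β) * Real.exp (_ * J t)
    have e : (1 + (Real.log (y t / (t * r t ^ (1 - β))) / (κ * J t) - 1)) * κ * J t =
        Real.log (y t / (t * r t ^ (1 - β))) := by field_simp; ring
    rw [e, Real.exp_log (div_pos (G.pos t ht) hm), mul_div_cancel₀ _ hm.ne']

theorem exists_eq_mul_exp_integral (G : IsGrowingFrom α β a r p τ y q T)
    (E : IsRVDelayEquation α β δ a r p τ) (h0 : 0 ≤ t₀) (ha : a ≤ t₀)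
    (hτ : ∀ t, t₀ ≤ t → a ≤ τ t) :
    ∃ ε η : ℝ → ℝ, ContinuousOn ε (Ici t₀) ∧ Tendsto ε atTop (𝓝 0) ∧ Tendsto η atTop (𝓝 0) ∧
      ∀ᶠ t in atTop, y t = (1 + η t) / rvIndex α δ * (t * r t ^ (1 - β)) *
        Real.exp (∫ s in t₀..t,
          (1 + ε s) * ((β - 1) / Phi α (rvIndex α δ)) * Htau α a r p τ s) := by
  have hϱ : 0 < rvIndex α δ ^ (α - 1) := Real.rpow_pos_of_pos E.rvIndex_pos _
  have hϱ0 := E.rvIndex_pos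
  obtain ⟨ε, hεc, hε0, hε⟩ := G.exists_integral_eq_log_q E h0 ha hτ
  refine ⟨ε, fun t => rvIndex α δ * (y t / (t * r t ^ (1 - β)) / q t ^ (β - 1)) - 1,
    hεc.continuousOn, hε0, ?_, ?_⟩
  · have := ((G.tendsto_div_main_term E).const_mul (rvIndex α δ)).sub_const 1
    rwa [mul_one_div, div_self hϱ0.ne', sub_self] at this
  · filter_upwards [hε, eventually_ge_atTop T] with t h1 ht
    have hq := G.q_pos t ht
    have hm := G.main_term_pos E ht
    have hqβ : 0 < q t ^ (β - 1) := Real.rpow_pos_of_pos hq _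
    have e : ∫ s in t₀..t, (1 + ε s) * ((β - 1) / Phi α (rvIndex α δ)) * Htau α a r p τ s =
        Real.log (q t) * (β - 1) := by
      rw [Phi_of_pos E.rvIndex_pos]
      calc _ = ∫ s in t₀..t, (β - 1) / rvIndex α δ ^ (α - 1) *
            ((1 + ε s) * Htau α a r p τ s) :=
            intervalIntegral.integral_congr fun s _ => by ring
        _ = _ := by
          rw [intervalIntegral.integral_const_mul, h1]
          field_simp
    have h2 : (1 + (rvIndex α δ * (y t / (t * r t ^ (1 - β)) / q t ^ (β - 1)) - 1)) /
        rvIndex α δ = y t / (t * r t ^ (1 - β)) / q t ^ (β - 1) := by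
      rw [add_sub_cancel, mul_div_cancel_left₀ _ hϱ0.ne']
    rw [e, ← Real.rpow_def_of_pos hq, h2, mul_right_comm, div_mul_cancel₀ _ hqβ.ne',
      div_mul_cancel₀ _ hm.ne']

/-! ### The convergent case -/

/-- When `H_τ` is integrable, so is `q' / q`, hence `log q` converges. -/
theorem exists_tendsto_q (G : IsGrowingFrom α β a r p τ y q T)
    (E : IsRVDelayEquation α β δ a r p τ) (hint : IntegrableOn (Htau α a r p τ) (Ioi t₀)) :
    ∃ M, 0 < M ∧ Tendsto q atTop (𝓝 M) ∧ ∃ S, T ≤ S ∧ t₀ ≤ S ∧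
      IntegrableOn (fun t => p t * y (τ t) ^ (α - 1) / q t) (Ioi S) ∧
      ∀ t, S ≤ t → ∫ s in Ioi t, p s * y (τ s) ^ (α - 1) / q s =
        Real.log M - Real.log (q t) := by
  obtain ⟨B, hB⟩ := eventually_atTop.1
    ((G.tendsto_deriv_q_div E).eventually_le_const (lt_add_one _))
  set S := max B (max T t₀)
  have hBS : B ≤ S := le_max_left _ _
  have hTS : T ≤ S := (le_max_left _ _).trans (le_max_right _ _)
  have htS : t₀ ≤ S := (le_max_right _ _).trans (le_max_right _ _)
  have hk : IntegrableOn (fun t => p t * y (τ t) ^ (α - 1) / q t) (Ioi S) := by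
    refine Integrable.mono' ((hint.mono_set (Ioi_subset_Ioi htS)).const_mul
      (1 / rvIndex α δ ^ (α - 1) + 1))
      (((G.continuousOn_deriv_log_q E).mono fun t ht =>
        hTS.trans (le_of_lt ht)).aestronglyMeasurable measurableSet_Ioi) ?_
    filter_upwards [ae_restrict_mem measurableSet_Ioi] with t ht
    have hSt : S ≤ t := le_of_lt ht
    have h1 := hB t (hBS.trans hSt)
    rw [div_le_iff₀ (G.Htau_pos E (hTS.trans hSt))] at h1
    rwa [Real.norm_of_nonneg (div_pos (G.deriv_q_pos E (hTS.trans hSt))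
      (G.q_pos t (hTS.trans hSt))).le]
  have hlim : ∀ s, S ≤ s → Tendsto (fun t => Real.log (q t)) atTop
      (𝓝 ((∫ u in Ioi s, p u * y (τ u) ^ (α - 1) / q u) + Real.log (q s))) := by
    intro s hs
    have h1 := (intervalIntegral_tendsto_integral_Ioi s (hk.mono_set (Ioi_subset_Ioi hs))
      tendsto_id).add_const (Real.log (q s))
    refine h1.congr' ?_
    filter_upwards [eventually_ge_atTop s] with t ht
    rw [id, (G.mono (hTS.trans hs)).integral_deriv_log_q E ht, sub_add_cancel]
  have hM := (Real.continuous_exp.tendsto _).comp (hlim S le_rfl)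
  refine ⟨_, Real.exp_pos _, hM.congr' ?_, S, hTS, htS, hk, fun t ht => ?_⟩
  · filter_upwards [eventually_ge_atTop T] with t ht
    exact Real.exp_log (G.q_pos t ht)
  · rw [Real.log_exp]
    have := tendsto_nhds_unique (hlim S le_rfl) (hlim t ht)
    linarith

/-- Beyond `S` the integrand is `y' = q^(β-1) r^(1-β)`, with `q` recovered from
`log M - log q = ∫_t^∞ q' / q`; the values of the integrand on `[t₀, S]` only affect `A`. -/
theorem exists_eq_add_integral (G : IsGrowingFrom α β a r p τ y q T)
    (E : IsRVDelayEquation α β δ a r p τ) (ha : a ≤ t₀)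
    (hτ : ∀ t, t₀ ≤ t → a ≤ τ t) {M S : ℝ} (hM : 0 < M) (hTS : T ≤ S) (htS : t₀ ≤ S)
    (hk : IntegrableOn (fun t => p t * y (τ t) ^ (α - 1) / q t) (Ioi S))
    (htail : ∀ t, S ≤ t → ∫ s in Ioi t, p s * y (τ s) ^ (α - 1) / q s =
      Real.log M - Real.log (q t)) :
    ∃ (A : ℝ) (ε : ℝ → ℝ), ContinuousOn ε (Ici t₀) ∧ Tendsto ε atTop (𝓝 0) ∧
      ∀ᶠ t in atTop, y t = A + ∫ s in t₀..t, M ^ (β - 1) * r s ^ (1 - β) *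
        Real.exp (-∫ ξ in Ioi s,
          (1 + ε ξ) * ((β - 1) / rvIndex α δ ^ (α - 1)) * Htau α a r p τ ξ) := by
  have hϱ : 0 < rvIndex α δ ^ (α - 1) := Real.rpow_pos_of_pos E.rvIndex_pos _
  have G' := G.mono hTS
  obtain ⟨ε, hεc, hε0, hε⟩ := G'.exists_relative_error E
  have hH : ContinuousOn (Htau α a r p τ) (Ici t₀) := E.continuousOn_Htau ha hτ
  set φ : ℝ → ℝ := fun ξ => (1 + ε ξ) * ((β - 1) / rvIndex α δ ^ (α - 1)) * Htau α a r p τ ξ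
    with hφ
  have hφc : ContinuousOn φ (Ici t₀) :=
    ((continuous_const.add hεc).mul continuous_const).continuousOn.mul hH
  have hφk : ∀ ξ, S ≤ ξ → φ ξ = (β - 1) * (p ξ * y (τ ξ) ^ (α - 1) / q ξ) := fun ξ hξ => by
    have h1 := hε ξ hξ
    have : φ ξ = (β - 1) / rvIndex α δ ^ (α - 1) * ((1 + ε ξ) * Htau α a r p τ ξ) := by
      simp only [hφ]; ring
    rw [this, h1]
    field_simp
  have hφS : IntegrableOn φ (Ioi S) := by
    refine IntegrableOn.congr_fun (hk.const_mul (β - 1)) (fun ξ hξ => ?_) measurableSet_Ioi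
    exact (hφk ξ (le_of_lt hξ)).symm
  have hφi : IntegrableOn φ (Ioi t₀) := by
    rw [← Ioc_union_Ioi_eq_Ioi htS]
    refine IntegrableOn.union ?_ hφS
    exact ((hφc.mono Icc_subset_Ici_self).integrableOn_Icc).mono_set Ioc_subset_Icc_self
  have hφii : ∀ s, t₀ ≤ s → IntervalIntegrable φ volume t₀ s := fun s hs =>
    ContinuousOn.intervalIntegrable (hφc.mono (by
      rw [uIcc_of_le hs]; exact Icc_subset_Ici_self))
  have hgc : ∀ t, t₀ ≤ t → ContinuousOn (fun s => ∫ ξ in Ioi s, φ ξ) (Icc t₀ t) := by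
    intro t ht
    have h1 := intervalIntegral.continuousOn_primitive_interval' (hφii t ht) left_mem_uIcc
    rw [uIcc_of_le ht] at h1
    refine ((continuousOn_const (c := ∫ ξ in Ioi t₀, φ ξ)).sub h1).congr fun s hs => ?_
    have := intervalIntegral.integral_interval_add_Ioi hφi
      (hφi.mono_set (Ioi_subset_Ioi hs.1))
    exact eq_sub_of_add_eq' this
  set m : ℝ → ℝ := fun s => M ^ (β - 1) * r s ^ (1 - β) * Real.exp (-∫ ξ in Ioi s, φ ξ) with hm
  have hmc : ∀ t, t₀ ≤ t → ContinuousOn m (Icc t₀ t) := fun t ht =>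
    (continuousOn_const.mul ((E.continuousOn_r.mono fun s hs => ha.trans hs.1).rpow_const
      fun s hs => Or.inl (E.r_pos s (ha.trans hs.1)).ne')).mul
        (Real.continuous_exp.comp_continuousOn (hgc t ht).neg)
  have hmi : ∀ t, t₀ ≤ t → IntervalIntegrable m volume t₀ t := fun t ht =>
    ContinuousOn.intervalIntegrable (by rw [uIcc_of_le ht]; exact hmc t ht)
  have hmS : ∀ s, S ≤ s → m s = q s ^ (β - 1) * r s ^ (1 - β) := fun s hs => by
    have hq := G'.q_pos s hs
    have e : ∫ ξ in Ioi s, φ ξ = (β - 1) * (Real.log M - Real.log (q s)) := by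
      rw [← htail s hs, ← integral_const_mul]
      exact setIntegral_congr_fun measurableSet_Ioi fun ξ hξ => hφk ξ (hs.trans (le_of_lt hξ))
    have e2 : M ^ (β - 1) * Real.exp (-((β - 1) * (Real.log M - Real.log (q s)))) =
        q s ^ (β - 1) := by
      rw [Real.rpow_def_of_pos hM, Real.rpow_def_of_pos hq, ← Real.exp_add]
      congr 1
      ring
    simp only [hm]
    rw [e, mul_right_comm, e2]
  refine ⟨y S - ∫ s in t₀..S, m s, ε, hεc.continuousOn, hε0, ?_⟩
  filter_upwards [eventually_ge_atTop S] with t ht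
  have hSt : IntervalIntegrable m volume S t :=
    (hmi S htS).symm.trans (hmi t (htS.trans ht))
  have h1 : ∫ s in S..t, m s = y t - y S := by
    refine intervalIntegral.integral_eq_sub_of_hasDerivAt (fun s hs => ?_) hSt
    rw [uIcc_of_le ht] at hs
    rw [hmS s hs.1]
    exact G'.hasDerivAt s hs.1
  have h2 := intervalIntegral.integral_add_adjacent_intervals (hmi S htS) hSt
  change y t = _ + ∫ s in t₀..t, m s
  rw [← h2, h1]
  ring

theorem lt_limit (G : IsGrowingFrom α β a r p τ y q T) (E : IsRVDelayEquation α β δ a r p τ)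
    {M : ℝ} (hM : Tendsto q atTop (𝓝 M)) {t : ℝ} (ht : T ≤ t) : q t < M := by
  have hs : StrictMonoOn q (Ici T) := strictMonoOn_of_deriv_pos (convex_Ici T) G.continuousOn_q
    fun s hs => by
      rw [(G.hasDerivAt_q s (interior_subset hs)).deriv]
      exact G.deriv_q_pos E (interior_subset hs)
  have h1 : q t < q (t + 1) := hs ht (ht.trans (le_add_of_nonneg_right zero_le_one)) (lt_add_one t)
  refine h1.trans_le (ge_of_tendsto hM ?_)
  filter_upwards [eventually_ge_atTop (t + 1)] with s hs'
  exact G.q_mono (ht.trans (le_add_of_nonneg_right zero_le_one))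
    ((ht.trans (le_add_of_nonneg_right zero_le_one)).trans hs') hs'

/-- `M - q(t)` exceeds every increment `q(λt) - q(t) ∼ t q'(t) log λ`, so it dominates
`t q'(t)`. -/
theorem tendsto_deriv_div_limit_sub (G : IsGrowingFrom α β a r p τ y q T)
    (E : IsRVDelayEquation α β δ a r p τ) {M : ℝ} (hM : Tendsto q atTop (𝓝 M)) :
    Tendsto (fun t => t * (p t * y (τ t) ^ (α - 1)) / (M - q t)) atTop (𝓝 0) := by
  have h : Tendsto (fun t => (M - q t) / (t * (p t * y (τ t) ^ (α - 1)))) atTop atTop := by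
    refine tendsto_atTop.2 fun b => ?_
    have h1 := G.tendsto_sub_div E (Real.exp_pos (b + 1))
    rw [Real.log_exp] at h1
    filter_upwards [h1.eventually (le_mem_nhds (lt_add_one b)), eventually_ge_atTop T,
      (tendsto_const_mul_atTop_self (Real.exp_pos (b + 1))).eventually_ge_atTop T] with t h2 h3 h4
    refine h2.trans (div_le_div_of_nonneg_right ?_
      (mul_pos (G.T_pos.trans_le h3) (G.deriv_q_pos E h3)).le)
    linarith [G.lt_limit E hM h4]
  refine h.inv_tendsto_atTop.congr fun t => ?_
  rw [Pi.inv_apply, inv_div]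

/-- `M - q` is slowly varying, since its increments are of the order of `t q'(t) = o(M - q(t))`. -/
theorem isSV_limit_sub (G : IsGrowingFrom α β a r p τ y q T)
    (E : IsRVDelayEquation α β δ a r p τ) {M : ℝ} (hM : Tendsto q atTop (𝓝 M)) :
    IsSV (fun t => M - q t) := by
  refine ⟨⟨T, fun t ht => sub_pos.2 (G.lt_limit E hM ht),
    measurable_domRestrict_of_continuousOn (continuousOn_const.sub G.continuousOn_q)⟩,
    fun l hl => ?_⟩
  have h := ((G.tendsto_sub_div E hl).mul (G.tendsto_deriv_div_limit_sub E hM)).const_sub 1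
  rw [mul_zero, sub_zero] at h
  rw [Real.rpow_zero]
  refine h.congr' ?_
  filter_upwards [eventually_ge_atTop T] with t ht
  have h1 := sub_pos.2 (G.lt_limit E hM ht)
  have h2 := G.deriv_q_pos E ht
  have h3 := G.T_pos.trans_le ht
  rw [div_mul_div_cancel₀ (mul_pos h3 h2).ne']
  field_simp
  ring

theorem tendsto_svPart_div (G : IsGrowingFrom α β a r p τ y q T)
    (E : IsRVDelayEquation α β δ a r p τ) {M : ℝ} (hM0 : 0 < M) (hM : Tendsto q atTop (𝓝 M)) :
    Tendsto (fun t => t ^ (δ + α) * tauDeriv a τ t ^ (α - 1) * svPart p δ t /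
      (τ t ^ (δ + α) * svPart r (δ + α) t * (M - q t))) atTop (𝓝 0) := by
  have h := (((G.tendsto_deriv_div_limit_sub E hM).mul ((G.tendsto_deriv_q_div E).inv₀
    (one_div_pos.2 (Real.rpow_pos_of_pos E.rvIndex_pos _)).ne')).mul
      (hM.inv₀ hM0.ne')).mul E.tendsto_r_delay
  rw [zero_mul, zero_mul, zero_mul] at h
  refine h.congr' ?_
  filter_upwards [eventually_ge_atTop T] with t ht
  have hat := G.a_lt.le.trans ht
  have ht0 := G.T_pos.trans_le ht
  have hτ0 := G.delay_pos t ht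
  have h1 := sub_pos.2 (G.lt_limit E hM ht)
  have h2 := G.deriv_q_pos E ht
  have hp := E.p_pos t hat
  have hr := E.r_pos t hat
  have hrτ := E.r_pos _ (G.a_lt_delay t ht).le
  have hq := G.q_pos t ht
  have hd := E.tauDeriv_pos t hat
  have hH := G.Htau_pos E ht
  -- The equation cancels, and only `t H_τ(t)` is left of the first three factors.
  have e : t * (p t * y (τ t) ^ (α - 1)) / (M - q t) *
      (p t * y (τ t) ^ (α - 1) / q t / Htau α a r p τ t)⁻¹ * (q t)⁻¹ =
      t * Htau α a r p τ t / (M - q t) := by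
    set k := p t * y (τ t) ^ (α - 1)
    field_simp
  have hα : t ^ α = t * t ^ (α - 1) := by
    rw [Real.rpow_sub_one ht0.ne']; field_simp
  have p1 : 0 < t ^ δ := Real.rpow_pos_of_pos ht0 _
  have p2 : 0 < t ^ (α - 1) := Real.rpow_pos_of_pos ht0 _
  have p3 : 0 < τ t ^ (δ + α) := Real.rpow_pos_of_pos hτ0 _
  have p4 : 0 < tauDeriv a τ t ^ (α - 1) := Real.rpow_pos_of_pos hd _
  rw [e, Htau, Real.mul_rpow ht0.le hd.le, Real.div_rpow ht0.le hτ0.le, svPart, svPart,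
    Real.rpow_add ht0, hα]
  field_simp

end IsGrowingFrom

/-! ### The classification -/

namespace IsRVDelayEquation

theorem isPi_quasiDeriv (E : IsRVDelayEquation α β δ a r p τ) (hy : y ∈ IS α a r p τ) :
    IsPi (quasiDeriv α r y) (fun t => t * p t * Phi α (y (τ t))) := by
  obtain ⟨T, G⟩ := E.exists_isGrowingFrom hy
  have e : ∀ t, T ≤ t → t * p t * Phi α (y (τ t)) = t * (p t * y (τ t) ^ (α - 1)) :=
    fun t ht => by rw [Phi_of_pos (G.pos_delay t ht), mul_assoc]
  refine ⟨⟨T, fun t ht => ?_, measurable_domRestrict_of_continuousOn G.continuousOn_q⟩,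
    fun l hl => (G.tendsto_sub_div E hl).congr' ?_⟩
  · simp only [e t ht]
    exact mul_pos (G.T_pos.trans_le ht) (G.deriv_q_pos E ht)
  · filter_upwards [eventually_ge_atTop T] with t ht
    rw [e t ht]

theorem tendsto_atTop_of_mem_IS (E : IsRVDelayEquation α β δ a r p τ) (hy : y ∈ IS α a r p τ) :
    Tendsto y atTop atTop := by
  obtain ⟨T, G⟩ := E.exists_isGrowingFrom hy
  exact (G.isNRV E).isRV.tendsto_atTop E.rvIndex_pos

theorem SolRV_eq_IS (E : IsRVDelayEquation α β δ a r p τ) :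
    SolRV α a r p τ (rvIndex α δ) = IS α a r p τ := by
  refine Subset.antisymm (fun y hy => E.mem_IS_of_tendsto_atTop hy.1
    (hy.2.tendsto_atTop E.rvIndex_pos)) fun y hy => ⟨hy.1, ?_⟩
  obtain ⟨T, G⟩ := E.exists_isGrowingFrom hy
  exact (G.isNRV E).isRV

theorem SolNRV_eq_SolRV (E : IsRVDelayEquation α β δ a r p τ) :
    SolNRV α a r p τ (rvIndex α δ) = SolRV α a r p τ (rvIndex α δ) := by
  refine Subset.antisymm (fun y hy => ⟨hy.1, hy.2.isRV⟩) fun y hy => ⟨hy.1, ?_⟩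
  rw [E.SolRV_eq_IS] at hy
  obtain ⟨T, G⟩ := E.exists_isGrowingFrom hy
  exact G.isNRV E

end IsRVDelayEquation

end HalfLinearDelay

theorem theorem3p4 (α β δ a : ℝ) (r p τ : ℝ → ℝ)
    (hα : 1 < α) (hβ : 1 / α + 1 / β = 1) (hδ : δ < -1)
    (hr : ContinuousOn r (Ici a)) (hr_pos : ∀ t, a ≤ t → 0 < r t)
    (hp : ContinuousOn p (Ici a)) (hp_pos : ∀ t, a ≤ t → 0 < p t)
    (hτ : ContDiffOn ℝ 1 τ (Ici a)) (hτ_deriv : ∀ t, a ≤ t → 0 < tauDeriv a τ t)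
    (hτ_le : ∀ t, a ≤ t → τ t ≤ t)
    (hτ_limsup : ∃ K : ℝ, ∀ᶠ t in atTop, 0 < τ t ∧ t / τ t ≤ K)
    (hpRV : IsRV p δ) (hrRV : IsRV r (δ + α))
    (hadd₁ : IsRV (fun t => r (τ t) ^ (1 - β) * tauDeriv a τ t) (δ * (1 - β) - β))
    (hadd₂ : Tendsto
      (fun t => (svPart p δ t / svPart r (δ + α) t) ^ (β - 1) * tauDeriv a τ t) atTop (𝓝 0)) :
    (∀ y ∈ IS α a r p τ, IsNRV y (rvIndex α δ) ∧
      IsPi (quasiDeriv α r y) (fun t => t * p t * Phi α (y (τ t)))) ∧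
    ∀ t₀ : ℝ, 0 ≤ t₀ → a ≤ t₀ → a ≤ τ t₀ →
      -- the divergent case
      (Tendsto (fun t => ∫ s in t₀..t, Htau α a r p τ s) atTop atTop →
        (∀ y ∈ IS α a r p τ,
          (∃ ε : ℝ → ℝ, Tendsto ε atTop (𝓝 0) ∧
            ∀ᶠ t in atTop, y t = t * r t ^ (1 - β) *
              Real.exp (∫ s in t₀..t,
                (1 + ε t) * ((β - 1) / Phi α (rvIndex α δ)) * Htau α a r p τ s)) ∧
          (∃ ε η : ℝ → ℝ, ContinuousOn ε (Ici t₀) ∧ Tendsto ε atTop (𝓝 0) ∧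
            Tendsto η atTop (𝓝 0) ∧
            ∀ᶠ t in atTop, y t = (1 + η t) / rvIndex α δ * (t * r t ^ (1 - β)) *
              Real.exp (∫ s in t₀..t,
                (1 + ε s) * ((β - 1) / Phi α (rvIndex α δ)) * Htau α a r p τ s))) ∧
        SolNRV α a r p τ (rvIndex α δ) = SolRV α a r p τ (rvIndex α δ) ∧
        SolRV α a r p τ (rvIndex α δ) = IS α a r p τ ∧
        IS α a r p τ = ISInfInf α a r p τ) ∧
      -- the convergent case
      (IntegrableOn (Htau α a r p τ) (Ioi t₀) →
        (∀ y ∈ IS α a r p τ, ∃ M : ℝ, 0 < M ∧ Tendsto (quasiDeriv α r y) atTop (𝓝 M) ∧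
          (∃ (A : ℝ) (ε : ℝ → ℝ), ContinuousOn ε (Ici t₀) ∧ Tendsto ε atTop (𝓝 0) ∧
            ∀ᶠ t in atTop, y t = A + ∫ s in t₀..t, M ^ (β - 1) * r s ^ (1 - β) *
              Real.exp (-∫ ξ in Ioi s,
                (1 + ε ξ) * ((β - 1) / rvIndex α δ ^ (α - 1)) * Htau α a r p τ ξ)) ∧
          IsSV (fun t => M - quasiDeriv α r y t) ∧
          Tendsto (fun t => t ^ (δ + α) * tauDeriv a τ t ^ (α - 1) * svPart p δ t /
            (τ t ^ (δ + α) * svPart r (δ + α) t * (M - quasiDeriv α r y t))) atTop (𝓝 0)) ∧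
        SolNRV α a r p τ (rvIndex α δ) = SolRV α a r p τ (rvIndex α δ) ∧
        SolRV α a r p τ (rvIndex α δ) = IS α a r p τ ∧
        IS α a r p τ = ISInfB α a r p τ) := by
  have hα0 : α ≠ 0 := by linarith
  have hβ0 : β ≠ 0 := by
    rintro rfl
    rw [div_zero, add_zero, div_eq_one_iff_eq hα0] at hβ
    linarith
  have hconj : (α - 1) * (β - 1) = 1 := by
    field_simp at hβ
    linarith
  have E : IsRVDelayEquation α β δ a r p τ := ⟨hα, hconj, hδ, hr, hr_pos, hp, hp_pos, hτ, hτ_deriv,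
    hτ_le, hτ_limsup, hpRV, hrRV, hadd₁, hadd₂⟩
  refine ⟨fun y hy => ⟨?_, E.isPi_quasiDeriv hy⟩, fun t₀ h0 ha hτ₀ => ?_⟩
  · obtain ⟨T, G⟩ := E.exists_isGrowingFrom hy
    exact G.isNRV E
  have hτt : ∀ t, t₀ ≤ t → a ≤ τ t := fun t ht =>
    hτ₀.trans (E.monotoneOn_delay ha (ha.trans ht) ht)
  refine ⟨fun hdiv => ⟨fun y hy => ?_, E.SolNRV_eq_SolRV, E.SolRV_eq_IS, ?_⟩,
    fun hint => ⟨fun y hy => ?_, E.SolNRV_eq_SolRV, E.SolRV_eq_IS, ?_⟩⟩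
  · obtain ⟨T, G⟩ := E.exists_isGrowingFrom hy
    exact ⟨G.exists_eq_mul_exp_of_divergent E ha hτt hdiv,
      G.exists_eq_mul_exp_integral E h0 ha hτt⟩
  · refine Subset.antisymm (fun y hy => ⟨hy, E.tendsto_atTop_of_mem_IS hy, ?_⟩) fun y hy => hy.1
    obtain ⟨T, G⟩ := E.exists_isGrowingFrom hy
    exact G.tendsto_q_atTop E ha hτt hdiv
  · obtain ⟨T, G⟩ := E.exists_isGrowingFrom hy
    obtain ⟨M, hM0, hM, S, hTS, htS, hk, htail⟩ := G.exists_tendsto_q E hint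
    exact ⟨M, hM0, hM, G.exists_eq_add_integral E ha hτt hM0 hTS htS hk htail,
      G.isSV_limit_sub E hM, G.tendsto_svPart_div E hM0 hM⟩
  · refine Subset.antisymm (fun y hy => ⟨hy, E.tendsto_atTop_of_mem_IS hy, ?_⟩) fun y hy => hy.1
    obtain ⟨T, G⟩ := E.exists_isGrowingFrom hy
    obtain ⟨M, hM0, hM, -⟩ := G.exists_tendsto_q E hint
    exact ⟨M, hM0.ne', hM⟩
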